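/- **Theorem.** All graphs are finite, simple and undirected, and classes of graphs are closed under isomorphism. Let $r \ge 3$ and $k \in \mathbb{N}$. For $n\in\mathbb N$, the *$r$-biclique of order $n$* is the $r$-subdivision of the complete bipartite graph $K_{n,n}$, i.e. the graph obtained from $K_{n,n}$ by replacing every edge with a path of length $r+1$. A *$k$-flip* of a graph $G$ is a graph $G'$ on the vertex set $V(G)$ for which there are a colouring $\lambda\colon V(G)\to\{1,\dots,k\}$ and a symmetric relation $R\subseteq\{1,\dots,k\}^2$ such that, for all distinct $u,v\in V(G)$, $uv\in E(G')$ if and only if exactly one of $uv\in E(G)$ and $(\lambda(u),\lambda(v))\in R$ holds. Let $\mathscr C$ be a hereditary class of graphs (closed under induced subgraphs) that contains, for every $n$, some $k$-flip of the $r$-biclique of order $n$. Then $\mathscr C$ effectively interprets the class of all graphs using only existential formulas on singletons. That is, there are first-order formulas $\delta(x)$ and $\varphi(x,y)$ in the language of graphs (adjacency and equality) such that * both are existential (they contain no universal quantifier, and negation is applied only to quantifier-free subformulas), and $\varphi$ is symmetric and irreflexive in every graph; and * there is a polynomial-time algorithm which, given any graph $H$, computes a graph $G\in\mathscr C$, whose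 number of vertices is polynomially bounded in $|V(H)|$, such that the graph $I_{\delta,\varphi}(G)$ with vertex set $\{v\in V(G) : G\models\delta(v)\}$ and edge set $\{uv : u\ne v,\ G\models\delta(u)\wedge\delta(v)\wedge\varphi(u,v)\}$ is isomorphic to $H$. -/

import Mathlib

open FirstOrder

/-! ### Finite graphs and graph classes -/

/-- A finite simple graph on the vertex set `{0, …, n - 1}`. Every finite graph is isomorphic to
one of these, so an isomorphism-closed class of finite graphs is a set of them. -/
abbrev FinGraph : Type := Σ n : ℕ, SimpleGraph (Fin n)

/-- A class of graphs is hereditary if it is closed under induced subgraphs (and isomorphism):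
`H ↪g G` is the type of isomorphisms of `H` with an induced subgraph of `G`. -/
def IsHereditary (C : Set FinGraph) : Prop :=
  ∀ G ∈ C, ∀ H : FinGraph, Nonempty (H.2 ↪g G.2) → H ∈ C

/-- The class contains the graph `G` up to isomorphism. -/
def ClassContains (C : Set FinGraph) {V : Type} (G : SimpleGraph V) : Prop :=
  ∃ H ∈ C, Nonempty (H.2 ≃g G)

/-! ### Flips -/

/-- `G'` is a `k`-flip of `G`. -/
def IsFlip {V : Type} (k : ℕ) (G G' : SimpleGraph V) : Prop :=
  ∃ (col : V → Fin k) (R : Fin k → Fin k → Prop), (∀ i j, R i j → R j i) ∧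
    ∀ u v, u ≠ v → (G'.Adj u v ↔ Xor (G.Adj u v) (R (col u) (col v)))

/-! ### Subdivided bicliques -/

/-- Vertices of the `r`-subdivision of the complete bipartite graph with sides of size `n`:
the native vertices of either side, and, for each edge `(i, j)`, the `r` inner vertices of the path
of length `r + 1` that replaces it, in order from `left i` to `right j`. -/
inductive BicliqueVertex (r n : ℕ) : Type
  | left (i : Fin n) : BicliqueVertex r n
  | right (j : Fin n) : BicliqueVertex r n
  | inner (i j : Fin n) (p : Fin r) : BicliqueVertex r n

/-- One orientation of the edges: `x` is the vertex just before `y` on one of the paths. -/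
def BicliqueVertex.Next {r n : ℕ} : BicliqueVertex r n → BicliqueVertex r n → Prop
  | .left i, .inner i' _ p => i = i' ∧ (p : ℕ) = 0
  | .inner i j p, .inner i' j' q => i = i' ∧ j = j' ∧ (p : ℕ) + 1 = q
  | .inner _ j p, .right j' => j = j' ∧ (p : ℕ) + 1 = r
  | .left _, .right _ => r = 0
  | _, _ => False

/-- The `r`-biclique of order `n`: the `r`-subdivision of `K_{n,n}`. -/
def subdividedBiclique (r n : ℕ) : SimpleGraph (BicliqueVertex r n) :=
  SimpleGraph.fromRel BicliqueVertex.Next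

/-! ### Existential formulas and interpretations -/

/-- Existential formulas: no universal quantifier, and negation only in quantifier-free
subformulas. -/
inductive IsExistentialFormula {α : Type} :
    ∀ {n : ℕ}, Language.graph.BoundedFormula α n → Prop
  | of_isQF {n : ℕ} {φ : Language.graph.BoundedFormula α n} (h : φ.IsQF) :
      IsExistentialFormula φ
  | inf {n : ℕ} {φ ψ : Language.graph.BoundedFormula α n} (hφ : IsExistentialFormula φ)
      (hψ : IsExistentialFormula ψ) : IsExistentialFormula (φ ⊓ ψ)
  | sup {n : ℕ} {φ ψ : Language.graph.BoundedFormula α n} (hφ : IsExistentialFormula φ)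
      (hψ : IsExistentialFormula ψ) : IsExistentialFormula (φ ⊔ ψ)
  | ex {n : ℕ} {φ : Language.graph.BoundedFormula α (n + 1)} (h : IsExistentialFormula φ) :
      IsExistentialFormula φ.ex

/-- `G ⊨ φ(a)`. -/
def GraphSat {V : Type} (G : SimpleGraph V) {m : ℕ} (φ : Language.graph.Formula (Fin m))
    (a : Fin m → V) : Prop :=
  @Language.Formula.Realize Language.graph V G.structure (Fin m) φ a

/-- A (one-dimensional) interpretation: a domain formula `δ(x)` and an edge formula `φ(x, y)`,
where `φ` is symmetric and irreflexive in all (finite) graphs. -/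
structure Interpretation where
  δ : Language.graph.Formula (Fin 1)
  φ : Language.graph.Formula (Fin 2)
  irrefl : ∀ {V : Type} [Finite V] (G : SimpleGraph V) (u : V), ¬ GraphSat G φ ![u, u]
  symm : ∀ {V : Type} [Finite V] (G : SimpleGraph V) (u v : V),
    GraphSat G φ ![u, v] → GraphSat G φ ![v, u]

/-- The graph `I(G)`. -/
def Interpretation.apply (I : Interpretation) {V : Type} [Finite V] (G : SimpleGraph V) :
    SimpleGraph {v : V // GraphSat G I.δ ![v]} where
  Adj u v := GraphSat G I.φ ![u.1, v.1]
  symm := ⟨fun u v h => I.symm G u.1 v.1 h⟩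
  loopless := ⟨fun u h => I.irrefl G u.1 h⟩

/-- The interpretation is existential. -/
def Interpretation.IsExistential (I : Interpretation) : Prop :=
  IsExistentialFormula I.δ ∧ IsExistentialFormula I.φ

/-! ### Effective interpretations -/

open Classical in
/-- The adjacency matrix of a graph as a string: the `0`-`1` rows in order, each of them followed
by the end-of-row symbol `none`. -/
noncomputable def encodeGraph (G : FinGraph) : List (Option Bool) :=
  (List.finRange G.1).flatMap fun i =>
    ((List.finRange G.1).map fun j => some (decide (G.2.Adj i j))) ++ [none]

/-- `C` effectively existentially interprets `D`: for some existential interpretation `I`, some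
map that a Turing machine computes in polynomial time takes each `H ∈ D` to a graph `G ∈ C` of size
polynomial in `|V(H)|` with `I(G)` (isomorphic to) `H`. -/
def EffectivelyExistentiallyInterprets (C D : Set FinGraph) : Prop :=
  ∃ I : Interpretation, I.IsExistential ∧
    ∃ f : {H : FinGraph // H ∈ D} → FinGraph,
      Nonempty (Turing.TM2ComputableInPolyTime (fun H => encodeGraph H.1) encodeGraph f) ∧
      (∃ p : Polynomial ℕ, ∀ H, (f H).1 ≤ p.eval H.1.1) ∧
      ∀ H, f H ∈ C ∧ Nonempty (I.apply (f H).2 ≃g H.1.2)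

/-! ### Existential formulas describing rooted induced subgraphs -/

section PatternFormula

open Language

/-! A Ramsey argument makes the flips uniform. Colouring each pair (i, j) by the flip colours along
its path and passing to a monochromatic subgrid gives flips that depend only on the r + 2 layers of
the biclique. There are finitely many relations `R` on layers, so a single `R` works for all orders,
and by heredity every induced subgraph of these layer flips lies in the class
(`exists_forall_layerFlip_mem`).

A graph `H` is encoded by a gadget: an induced subgraph of a biclique in which vertices are hubs
with three pendant leaves and each edge is a pair of subdivided arms meeting in a middle vertex,
flipped by `R`. Before the flip, only hubs have degree at least three. The formulas say that the
gadget of a single vertex, respectively of an edge, embeds as an induced subgraph with its hubs at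
the free variables; such formulas are existential. Gadgets are functorial for embeddings, so hubs
and edges satisfy the formulas.

For the converse, an embedding between flipped gadgets must not exploit the flip. Each gadget
contains many disjoint pads, small cyclic subgraphs meeting all layers. By pigeonhole six of them
have the same pattern of image layers; a disagreement of the flips would force adjacent native
vertices, which do not exist (`adj_iff_of_flip_embedding`). Hence embeddings preserve unflipped
adjacency, so hubs go to hubs by degree (`exists_hub_map`) and arms to arms by following paths
(`adj_of_hub_map`).

For effectiveness, every cell of the encoded adjacency matrix carries a copy of the same finite set
of vertex kinds, and adjacency depends only on kinds and a few equality tests between cells. A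
machine that repeatedly sweeps over its input while maintaining these tests as marks prints the
gadget in polynomial time (`computable_gadgetFinGraph`). -/

lemma BoundedFormula.isQF_iInf {L : Language} {α : Type} {n : ℕ} {β : Type} [Finite β]
    {f : β → L.BoundedFormula α n} (h : ∀ b, (f b).IsQF) :
    (BoundedFormula.iInf f).IsQF := by
  have key : ∀ l : List β, ((l.map f).foldr (· ⊓ ·) ⊤).IsQF := by
    intro l
    induction l with
    | nil => exact BoundedFormula.IsQF.top
    | cons b l ih => exact (h b).inf ih
  exact key _

lemma IsExistentialFormula.exs {α : Type} : ∀ {n : ℕ} {φ : Language.graph.BoundedFormula α n},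
    IsExistentialFormula φ → IsExistentialFormula φ.exs
  | 0, _, h => h
  | _ + 1, φ, h => IsExistentialFormula.exs (φ := φ.ex) (.ex h)

/-- The quantifier-free condition on a pair of bound variables that says that they are related in
the same way as the vertices `u`, `v` of `P`. -/
noncomputable def pairFormula {N c : ℕ} (P : SimpleGraph (Fin N)) (u v : Fin N) :
    Language.graph.BoundedFormula (Fin c) N :=
  open Classical in
  (if u = v then ⊤ else ∼(Term.bdEqual (&u) (&v))) ⊓
    (if P.Adj u v then adj.boundedFormula₂ (&u) (&v)
      else ∼(adj.boundedFormula₂ (&u) (&v)))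

/-- The formula saying that `P` embeds as an induced subgraph with the roots `a` at the free
variables. -/
noncomputable def patternFormula {N c : ℕ} (P : SimpleGraph (Fin N)) (a : Fin c → Fin N) :
    Language.graph.Formula (Fin c) :=
  BoundedFormula.exs
    ((BoundedFormula.iInf fun uv : Fin N × Fin N => pairFormula P uv.1 uv.2) ⊓
      BoundedFormula.iInf fun i : Fin c => Term.bdEqual (Term.var (Sum.inl i)) (&(a i)))

lemma isExistentialFormula_patternFormula {N c : ℕ} (P : SimpleGraph (Fin N))
    (a : Fin c → Fin N) : IsExistentialFormula (patternFormula P a) := by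
  refine IsExistentialFormula.exs (.of_isQF (.inf (BoundedFormula.isQF_iInf ?_)
    (BoundedFormula.isQF_iInf fun i => (BoundedFormula.IsAtomic.equal _ _).isQF)))
  rintro ⟨u, v⟩
  refine .inf ?_ ?_
  · split_ifs
    · exact .top
    · exact (BoundedFormula.IsAtomic.equal _ _).isQF.not
  · split_ifs
    · exact (BoundedFormula.IsAtomic.rel _ _).isQF
    · exact (BoundedFormula.IsAtomic.rel _ _).isQF.not

/-- Adjacency and non-adjacency are both recorded for each pair, so a satisfying tuple amounts to an
induced embedding; negation meets only atoms. -/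
lemma graphSat_patternFormula {N c : ℕ} (P : SimpleGraph (Fin N)) (a : Fin c → Fin N)
    {V : Type} (G : SimpleGraph V) (x : Fin c → V) :
    GraphSat G (patternFormula P a) x ↔ ∃ h : P ↪g G, ∀ i, h (a i) = x i := by
  let := G.structure
  have hadj : ∀ y z : V, Structure.RelMap adj ![y, z] ↔ G.Adj y z := fun y z => Iff.rfl
  have hpair : ∀ (xs : Fin N → V) (u v : Fin N),
      (pairFormula (c := c) P u v).Realize x xs ↔
        (u ≠ v → xs u ≠ xs v) ∧ (P.Adj u v ↔ G.Adj (xs u) (xs v)) := by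
    intro xs u v
    rw [pairFormula, BoundedFormula.realize_inf]
    refine and_congr ?_ ?_
    · split_ifs with h <;> simp [h]
    · split_ifs with h <;> simp [h, hadj]
  unfold GraphSat patternFormula
  rw [BoundedFormula.realize_exs]
  simp only [BoundedFormula.realize_inf, BoundedFormula.realize_iInf, hpair, Prod.forall]
  constructor
  · rintro ⟨xs, h, hx⟩
    refine ⟨⟨⟨xs, fun u v huv => ?_⟩, ?_⟩, fun i => ?_⟩
    · by_contra hne
      exact (h u v).1 hne huv
    · intro u v
      exact (h u v).2.symm
    · have := hx i
      simp at this
      exact this.symm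
  · rintro ⟨h, hx⟩
    refine ⟨h, fun u v => ⟨fun huv => fun he => huv (h.injective he), (h.map_adj_iff).symm⟩,
      fun i => ?_⟩
    simp [hx i]

end PatternFormula

/-! ### Layers of subdivided bicliques and Ramsey -/

section Layers

instance (r n : ℕ) : Finite (BicliqueVertex r n) := by
  let f : BicliqueVertex r n → (Fin n ⊕ Fin n) ⊕ (Fin n × Fin n × Fin r) := fun v => match v with
    | .left i => .inl (.inl i)
    | .right j => .inl (.inr j)
    | .inner i j p => .inr (i, j, p)
  refine Finite.of_injective f ?_
  rintro (i | i | ⟨i, j, p⟩) (i' | i' | ⟨i', j', p'⟩) h <;> simp_all [f]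

/-- The position of a vertex on the paths of the subdivided biclique, from left to right. -/
def BicliqueVertex.layer {r n : ℕ} : BicliqueVertex r n → Fin (r + 2)
  | .left _ => 0
  | .inner _ _ p => p.succ.castSucc
  | .right _ => Fin.last _

lemma BicliqueVertex.layer_surjective {r n : ℕ} (hn : 0 < n) :
    Function.Surjective (BicliqueVertex.layer (r := r) (n := n)) := by
  intro l
  induction l using Fin.lastCases with
  | last => exact ⟨.right ⟨0, hn⟩, rfl⟩
  | cast l =>
    induction l using Fin.cases with
    | zero => exact ⟨.left ⟨0, hn⟩, rfl⟩
    | succ p => exact ⟨.inner ⟨0, hn⟩ ⟨0, hn⟩ p, rfl⟩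

/-- The flip of the subdivided biclique in which the pairs of layers related by `R` are
complemented. -/
def layerFlip {r : ℕ} (R : Fin (r + 2) → Fin (r + 2) → Prop) (hR : ∀ a b, R a b → R b a) (n : ℕ) :
    SimpleGraph (BicliqueVertex r n) where
  Adj u v := u ≠ v ∧ Xor ((subdividedBiclique r n).Adj u v) (R u.layer v.layer)
  symm := ⟨fun u v ⟨h, h'⟩ => ⟨h.symm, by
    rwa [SimpleGraph.adj_comm, show R v.layer u.layer ↔ R u.layer v.layer from ⟨hR _ _, hR _ _⟩]⟩⟩
  loopless := ⟨fun _ h => h.1 rfl⟩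

/-- The map of subdivided bicliques induced by maps of both sides. -/
def BicliqueVertex.map {r n m : ℕ} (f g : Fin n → Fin m) :
    BicliqueVertex r n → BicliqueVertex r m
  | .left i => .left (f i)
  | .right j => .right (g j)
  | .inner i j p => .inner (f i) (g j) p

lemma BicliqueVertex.map_injective {r n m : ℕ} {f g : Fin n → Fin m} (hf : f.Injective)
    (hg : g.Injective) : (BicliqueVertex.map (r := r) f g).Injective := by
  rintro (i | i | ⟨i, j, p⟩) (i' | i' | ⟨i', j', p'⟩) h <;>
    simp_all [BicliqueVertex.map, hf.eq_iff, hg.eq_iff]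

lemma BicliqueVertex.next_map {r n m : ℕ} {f g : Fin n → Fin m} (hf : f.Injective)
    (hg : g.Injective) (u v : BicliqueVertex r n) : (u.map f g).Next (v.map f g) ↔ u.Next v := by
  rcases u with (i | i | ⟨i, j, p⟩) <;> rcases v with (i' | i' | ⟨i', j', p'⟩) <;>
    simp [BicliqueVertex.map, BicliqueVertex.Next, hf.eq_iff, hg.eq_iff]

lemma subdividedBiclique_adj_map {r n m : ℕ} {f g : Fin n → Fin m} (hf : f.Injective)
    (hg : g.Injective) (u v : BicliqueVertex r n) :
    (subdividedBiclique r m).Adj (u.map f g) (v.map f g) ↔ (subdividedBiclique r n).Adj u v := by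
  simp [subdividedBiclique, SimpleGraph.fromRel_adj, BicliqueVertex.next_map hf hg,
    (BicliqueVertex.map_injective hf hg).eq_iff]

@[simp] lemma BicliqueVertex.layer_map {r n m : ℕ} (f g : Fin n → Fin m)
    (u : BicliqueVertex r n) : (u.map f g).layer = u.layer := by
  cases u <;> rfl

/-- Larger layer flips contain the smaller ones. -/
def layerFlipEmbedding {r : ℕ} (R : Fin (r + 2) → Fin (r + 2) → Prop) (hR : ∀ a b, R a b → R b a)
    {n m : ℕ} (h : n ≤ m) : layerFlip R hR n ↪g layerFlip R hR m where
  toFun := BicliqueVertex.map (Fin.castLE h) (Fin.castLE h)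
  inj' := BicliqueVertex.map_injective (Fin.castLE_injective h) (Fin.castLE_injective h)
  map_rel_iff' {u v} := by
    simp [layerFlip, subdividedBiclique_adj_map (Fin.castLE_injective h) (Fin.castLE_injective h),
      (BicliqueVertex.map_injective (r := r) (Fin.castLE_injective h)
        (Fin.castLE_injective h)).eq_iff]

/-- A set of size at least `n`, as the image of an injection. -/
lemma exists_embedding_fiber {α β : Type} [Fintype α] [Finite β] [Nonempty β] (f : α → β) {n : ℕ}
    (h : Nat.card β * n ≤ Fintype.card α) : ∃ (y : β) (g : Fin n ↪ α), ∀ i, f (g i) = y := by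
  classical
  have := Fintype.ofFinite β
  rw [Nat.card_eq_fintype_card] at h
  obtain ⟨y, hy⟩ := Fintype.exists_le_card_fiber_of_mul_le_card f h
  obtain ⟨s, hs, hcard⟩ := Finset.exists_subset_card_eq hy
  refine ⟨y, (s.equivFinOfCardEq hcard).symm.toEmbedding.trans (.subtype _), fun i => ?_⟩
  have := hs ((s.equivFinOfCardEq hcard).symm i).2
  simpa using this

/-- Every colouring of a large grid with finitely many colours is constant on an `n × n` subgrid. -/
lemma exists_monochromatic_grid (κ : Type) [Finite κ] (n : ℕ) : ∃ M : ℕ, ∀ c : Fin M → Fin M → κ,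
    ∃ (f g : Fin n ↪ Fin M), ∀ i j i' j', c (f i) (g j) = c (f i') (g j') := by
  rcases isEmpty_or_nonempty κ with hκ | hκ
  · exact ⟨n, fun c => ⟨.refl _, .refl _, fun i j => hκ.elim (c i j)⟩⟩
  -- Pigeonhole twice: on `t` columns, `n` rows share one pattern, and `t` is large enough for that
  -- pattern to repeat a value `n` times. The summand `t` in the bound makes those columns
  -- available.
  let t := Nat.card κ * n
  refine ⟨Nat.card (Fin t → κ) * n + t, fun c => ?_⟩
  obtain ⟨y, f, hf⟩ := exists_embedding_fiber (n := n)
    (fun (i : Fin (Nat.card (Fin t → κ) * n + t)) (j : Fin t) =>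
      c i (Fin.castLE (Nat.le_add_left _ _) j)) (by simp)
  obtain ⟨x, g, hg⟩ := exists_embedding_fiber (n := n) y (by simp [t])
  have key : ∀ i j, c (f i) (Fin.castLE (Nat.le_add_left _ _) (g j)) = x := fun i j => by
    rw [← hg j, ← hf i]
  exact ⟨f, g.trans (Fin.castLEEmb (Nat.le_add_left _ _)), fun i j i' j' =>
    (key i j).trans (key i' j').symm⟩

/-- A class with a `k`-flip of every biclique contains, for every `n`, a flip of the biclique of
order `n` that depends only on the layers. -/
lemma exists_layerFlip_mem {r k : ℕ} {C : Set FinGraph} (hC : IsHereditary C)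
    (hflip : ∀ n : ℕ, ∃ G : SimpleGraph (BicliqueVertex r n),
      IsFlip k (subdividedBiclique r n) G ∧ ClassContains C G) {n : ℕ} (hn : 0 < n) :
    ∃ (R : Fin (r + 2) → Fin (r + 2) → Prop) (hR : ∀ a b, R a b → R b a),
      ∀ H : FinGraph, Nonempty (H.2 ↪g layerFlip R hR n) → H ∈ C := by
  obtain ⟨M, hM⟩ := exists_monochromatic_grid (Fin k × Fin k × (Fin r → Fin k)) n
  obtain ⟨G, ⟨col, R, hR, hG⟩, ⟨G', hG'C, ⟨iso⟩⟩⟩ := hflip M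
  -- The colour of a pair records the whole path including both ends, so on the subgrid every layer
  -- is monochromatic.
  obtain ⟨f, g, hfg⟩ := hM fun i j => (col (.left i), col (.right j), fun p => col (.inner i j p))
  let z : Fin n := ⟨0, hn⟩
  obtain ⟨sec, hsec⟩ := (BicliqueVertex.layer_surjective (r := r) hn).hasRightInverse
  have hcol : ∀ u v : BicliqueVertex r n, u.layer = v.layer →
      col (u.map f g) = col (v.map f g) := by
    have h1 : ∀ i i', col (.left (f i)) = col (.left (f i')) := fun i i' =>
      congrArg (·.1) (hfg i z i' z)
    have h2 : ∀ j j', col (.right (g j)) = col (.right (g j')) := fun j j' =>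
      congrArg (·.2.1) (hfg z j z j')
    have h3 : ∀ i j i' j' p, col (.inner (f i) (g j) p) = col (.inner (f i') (g j') p) :=
      fun i j i' j' p => congrFun (congrArg (·.2.2) (hfg i j i' j')) p
    rintro (i | i | ⟨i, j, p⟩) (i' | i' | ⟨i', j', p'⟩) h <;>
      simp only [BicliqueVertex.layer, Fin.ext_iff, Fin.val_zero, Fin.val_last,
        Fin.val_castSucc, Fin.val_succ] at h
    · exact h1 _ _
    · omega
    · omega
    · omega
    · exact h2 _ _
    · omega
    · omega
    · omega
    · obtain rfl : p = p' := Fin.ext (by omega)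
      exact h3 _ _ _ _ _
  have hinj := BicliqueVertex.map_injective (r := r) f.injective g.injective
  refine ⟨fun a b => R (col ((sec a).map f g)) (col ((sec b).map f g)), fun a b => hR _ _,
    fun H ⟨e⟩ => hC G' hG'C H ⟨?_⟩⟩
  refine e.trans (RelEmbedding.trans ⟨⟨BicliqueVertex.map f g, hinj⟩, ?_⟩
    iso.symm.toRelEmbedding)
  intro u v
  by_cases huv : u = v
  · simp [huv]
  · change G.Adj (u.map f g) (v.map f g) ↔ _
    rw [hG _ _ (hinj.ne huv), subdividedBiclique_adj_map f.injective g.injective]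
    simp only [layerFlip, ne_eq, huv, not_false_iff, true_and]
    rw [hcol (sec u.layer) u (hsec _), hcol (sec v.layer) v (hsec _)]

/-- If each of the finitely many `R` failed at some order `N R`, the relation obtained for an order
above the sum of all `N R` would contradict its own failure, as larger layer flips contain smaller
ones. -/
lemma exists_forall_layerFlip_mem {r k : ℕ} {C : Set FinGraph} (hC : IsHereditary C)
    (hflip : ∀ n : ℕ, ∃ G : SimpleGraph (BicliqueVertex r n),
      IsFlip k (subdividedBiclique r n) G ∧ ClassContains C G) :
    ∃ (R : Fin (r + 2) → Fin (r + 2) → Prop) (hR : ∀ a b, R a b → R b a),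
      ∀ (n : ℕ) (H : FinGraph), Nonempty (H.2 ↪g layerFlip R hR n) → H ∈ C := by
  by_contra! hcon
  have := Fintype.ofFinite {R : Fin (r + 2) → Fin (r + 2) → Prop // ∀ a b, R a b → R b a}
  choose! N H hH hHC using fun R : {R : Fin (r + 2) → Fin (r + 2) → Prop //
    ∀ a b, R a b → R b a} => hcon R.1 R.2
  obtain ⟨R, hR, h⟩ := exists_layerFlip_mem hC hflip (Nat.succ_pos (∑ R, N R))
  obtain ⟨e⟩ := hH ⟨R, hR⟩
  exact hHC ⟨R, hR⟩ (h _ ⟨e.trans (layerFlipEmbedding R hR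
    ((Finset.single_le_sum (fun _ _ => Nat.zero_le _) (Finset.mem_univ _)).trans
      (Nat.le_succ _)))⟩)

end Layers

/-! ### The structure of subdivided bicliques -/

section Biclique

variable {r n : ℕ}

lemma BicliqueVertex.not_next_self (u : BicliqueVertex r n) : ¬ u.Next u := by
  rcases u with (i | i | ⟨i, j, p⟩) <;> simp [BicliqueVertex.Next]

lemma subdividedBiclique_adj {u v : BicliqueVertex r n} :
    (subdividedBiclique r n).Adj u v ↔ u.Next v ∨ v.Next u := by
  rw [subdividedBiclique, SimpleGraph.fromRel_adj, and_iff_right_iff_imp]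
  rintro h rfl
  exact u.not_next_self (h.elim id id)

/-- The native vertices of a subdivided biclique are those on its two sides. -/
def BicliqueVertex.IsNative : BicliqueVertex r n → Prop
  | .inner _ _ _ => False
  | _ => True

lemma BicliqueVertex.next_unique {i j : Fin n} {p : Fin r} {u v : BicliqueVertex r n}
    (hu : (BicliqueVertex.inner i j p).Next u) (hv : (BicliqueVertex.inner i j p).Next v) :
    u = v := by
  rcases u with (_ | _ | ⟨i', j', p'⟩) <;> rcases v with (_ | _ | ⟨i'', j'', p''⟩) <;>
    simp only [BicliqueVertex.Next] at hu hv
  · rw [← hu.1, ← hv.1]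
  · have := p''.2; omega
  · have := p'.2; omega
  · obtain ⟨rfl, rfl, h⟩ := hu
    obtain ⟨rfl, rfl, h'⟩ := hv
    rw [Fin.ext (h.symm.trans h')]

lemma BicliqueVertex.prev_unique {i j : Fin n} {p : Fin r} {u v : BicliqueVertex r n}
    (hu : u.Next (.inner i j p)) (hv : v.Next (.inner i j p)) : u = v := by
  rcases u with (_ | _ | ⟨i', j', p'⟩) <;> rcases v with (_ | _ | ⟨i'', j'', p''⟩) <;>
    simp only [BicliqueVertex.Next] at hu hv
  · rw [hu.1, hv.1]
  · omega
  · omega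
  · obtain ⟨rfl, rfl, h⟩ := hu
    obtain ⟨rfl, rfl, h'⟩ := hv
    rw [Fin.ext (Nat.succ_injective (h.trans h'.symm))]

/-- A vertex with three neighbours is native. -/
lemma isNative_of_three_adj {u a b c : BicliqueVertex r n}
    (ha : (subdividedBiclique r n).Adj u a) (hb : (subdividedBiclique r n).Adj u b)
    (hc : (subdividedBiclique r n).Adj u c) (hab : a ≠ b) (hac : a ≠ c) (hbc : b ≠ c) :
    u.IsNative := by
  rw [subdividedBiclique_adj] at ha hb hc
  rcases u with (_ | _ | ⟨i, j, p⟩)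
  · trivial
  · trivial
  · rcases ha with ha | ha <;> rcases hb with hb | hb <;> rcases hc with hc | hc <;>
      first
      | exact absurd (BicliqueVertex.next_unique ha hb) hab
      | exact absurd (BicliqueVertex.next_unique ha hc) hac
      | exact absurd (BicliqueVertex.next_unique hb hc) hbc
      | exact absurd (BicliqueVertex.prev_unique ha hb) hab
      | exact absurd (BicliqueVertex.prev_unique ha hc) hac
      | exact absurd (BicliqueVertex.prev_unique hb hc) hbc

lemma not_adj_of_isNative (hr : 0 < r) {u v : BicliqueVertex r n} (hu : u.IsNative)
    (hv : v.IsNative) : ¬ (subdividedBiclique r n).Adj u v := by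
  rw [subdividedBiclique_adj]
  rcases u with (_ | _ | _) <;> rcases v with (_ | _ | _) <;>
    simp_all [BicliqueVertex.Next, BicliqueVertex.IsNative, hr.ne']

/-- A path of length `r + 1` without backtracking from a left vertex runs along one subdivided
edge. -/
lemma path_from_left (hr : 0 < r) {x : Fin n} {q : ℕ → BicliqueVertex r n} (h0 : q 0 = .left x)
    (hadj : ∀ t < r + 1, (subdividedBiclique r n).Adj (q t) (q (t + 1)))
    (hne : ∀ t, t + 2 ≤ r + 1 → q t ≠ q (t + 2)) :
    ∃ y, q 1 = .inner x y ⟨0, hr⟩ ∧ q (r + 1) = .right y := by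
  have h1 : ∃ y, q 1 = .inner x y ⟨0, hr⟩ := by
    have h := hadj 0 (by omega)
    rw [h0, subdividedBiclique_adj, zero_add] at h
    rcases hq : q 1 with (_ | _ | ⟨i, j, p⟩) <;> rw [hq] at h <;>
      simp only [BicliqueVertex.Next, or_self, or_false] at h
    · omega
    · exact ⟨j, by rw [← h.1, show p = ⟨0, hr⟩ from Fin.ext h.2]⟩
  obtain ⟨y, hy⟩ := h1
  -- An inner vertex has one predecessor and one successor; having come from the predecessor, the
  -- path cannot turn back.
  have forward : ∀ t (ht : t < r), q (t + 1) = .inner x y ⟨t, ht⟩ →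
      (q t).Next (.inner x y ⟨t, ht⟩) → (BicliqueVertex.inner x y ⟨t, ht⟩).Next (q (t + 2)) := by
    intro t ht hq hprev
    have h := hadj (t + 1) (by omega)
    rw [hq, subdividedBiclique_adj] at h
    exact h.resolve_right fun h => hne t (by omega) (BicliqueVertex.prev_unique hprev h)
  have main : ∀ t (ht : t < r), q (t + 1) = .inner x y ⟨t, ht⟩ ∧
      (q t).Next (.inner x y ⟨t, ht⟩) := by
    intro t
    induction t with
    | zero => exact fun _ => ⟨hy, by rw [h0]; exact ⟨rfl, rfl⟩⟩
    | succ t ih =>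
      intro ht
      obtain ⟨hq, hprev⟩ := ih (by omega)
      have h := forward t (by omega) hq hprev
      rcases hq2 : q (t + 2) with (_ | _ | ⟨i, j, p⟩) <;> rw [hq2] at h <;>
        simp only [BicliqueVertex.Next] at h
      · omega
      · obtain ⟨rfl, rfl, h⟩ := h
        obtain rfl : p = ⟨t + 1, ht⟩ := Fin.ext h.symm
        exact ⟨rfl, by rw [hq]; exact ⟨rfl, rfl, rfl⟩⟩
  refine ⟨y, hy, ?_⟩
  obtain ⟨s, rfl⟩ : ∃ s, r = s + 1 := ⟨r - 1, by omega⟩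
  obtain ⟨hq, hprev⟩ := main s (by omega)
  have h := forward s (by omega) hq hprev
  rcases hq2 : q (s + 2) with (_ | _ | ⟨i, j, p⟩) <;> rw [hq2] at h <;>
    simp only [BicliqueVertex.Next] at h
  · rw [h.1]
  · omega

end Biclique

/-! ### Induced embeddings into layer flips -/

section Rigidity

/-- If `σ : W → L` preserves `R` along a surjective labelling `lay : W → L` of a finite set, then
labels that `σ` cannot tell apart have the same relations. -/
lemma rel_iff_of_twin {L W V : Type} [Finite L] {R : L → L → Prop} (hR : ∀ a b, R a b → R b a)
    {lay σ : W → L} (hlay : lay.Surjective)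
    (hσ : ∀ w w', R (lay w) (lay w') ↔ R (σ w) (σ w')) {a b : V → L}
    (hab : ∀ v w, R (a v) (lay w) ↔ R (b v) (σ w)) (u v : V) :
    R (a u) (a v) ↔ R (b u) (b v) := by
  have hR' : ∀ a b, R a b ↔ R b a := fun a b => ⟨hR a b, hR b a⟩
  obtain ⟨sec, hsec⟩ := hlay.hasRightInverse
  let S : Setoid L := Setoid.ker R
  let F : L → Quotient S := fun l => ⟦σ (sec l)⟧
  -- `F` follows `σ` on representatives and remembers only the row of `R`; it separates labels with
  -- different rows.
  have hF : ∀ l l' : L, F l = F l' → R l = R l' := by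
    intro l l' h
    have h : R (σ (sec l)) = R (σ (sec l')) := Quotient.exact h
    funext l''
    have h1 := hσ (sec l) (sec l'')
    have h2 := hσ (sec l') (sec l'')
    rw [h, ← h2] at h1
    simpa [hsec _] using h1
  -- On the finite set of row classes `F` is injective, hence surjective: every label is a twin of
  -- some value of `σ`.
  have hsurj : Function.Surjective fun q : Quotient S => F q.out := by
    refine Finite.injective_iff_surjective.1 fun q q' h => ?_
    rw [← q.out_eq, ← q'.out_eq]
    exact Quotient.sound (hF _ _ h)
  have hF' : ∀ l l' : L, R l = R l' → F l = F l' := by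
    intro l l' h
    refine Quotient.sound ?_
    change R (σ (sec l)) = R (σ (sec l'))
    have key : ∀ m, R (σ (sec l)) m ↔ R (σ (sec l')) m := by
      intro m
      obtain ⟨q, hq⟩ := hsurj ⟦m⟧
      have hq : R (σ (sec q.out)) = R m := Quotient.exact hq
      rw [hR', hR' _ m, ← hq, ← hσ, ← hσ, hsec, hsec, hsec, hR' _ l, hR' _ l', h]
    exact funext fun m => propext (key m)
  -- The labels `σ (sec (a v))` and `b v` have equal rows, so one may replace the other in `R`.
  have twin : ∀ v, R (σ (sec (a v))) = R (b v) := by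
    intro v
    obtain ⟨q, hq⟩ := hsurj ⟦b v⟧
    have hl : R (σ (sec q.out)) = R (b v) := Quotient.exact hq
    set l := q.out
    have hrow : R (a v) = R l := by
      funext l'
      have h1 := hab v (sec l')
      have h2 := hσ (sec l) (sec l')
      rw [hsec] at h1 h2
      rw [hsec] at h2
      rw [← hl] at h1
      exact propext (h1.trans h2.symm)
    rw [← hl]
    exact Quotient.exact (hF' _ _ hrow)
  rw [← twin u, hR', ← hsec (a u), hab v (sec (a u)), hsec, hR']

lemma iff_of_xor_iff_xor {a b p q : Prop} (h : Xor a p ↔ Xor b q) (hpq : p ↔ q) : a ↔ b := by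
  unfold Xor at h
  tauto

/-- An embedding of a flip of a graph with many disjoint isomorphic pads into a layer flip of a
subdivided biclique is an embedding of the unflipped graphs. -/
theorem adj_iff_of_flip_embedding {r M : ℕ} (hr : 0 < r)
    {R : Fin (r + 2) → Fin (r + 2) → Prop} (hR : ∀ a b, R a b → R b a)
    {V W : Type} [Finite W] {G₀ : SimpleGraph V} {lay : V → Fin (r + 2)}
    {h : V → BicliqueVertex r M} (hinj : h.Injective)
    (hh : ∀ u v, u ≠ v → (Xor (G₀.Adj u v) (R (lay u) (lay v)) ↔
      Xor ((subdividedBiclique r M).Adj (h u) (h v)) (R (h u).layer (h v).layer)))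
    {layW : W → Fin (r + 2)} (hlayW : layW.Surjective)
    {pad : W → (W → Fin (r + 2)) × Fin 6 → V}
    (hpad : ∀ w s w' s', pad w s = pad w' s' → s = s')
    (hlay : ∀ w s, lay (pad w s) = layW w)
    (hfar : ∀ v s, (∀ w, v ≠ pad w s) → ∀ w, ¬ G₀.Adj v (pad w s))
    (hdeg : ∀ w s, ∃ w₁ w₂, pad w₁ s ≠ pad w₂ s ∧ G₀.Adj (pad w s) (pad w₁ s) ∧
      G₀.Adj (pad w s) (pad w₂ s)) (u v : V) :
    G₀.Adj u v ↔ (subdividedBiclique r M).Adj (h u) (h v) := by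
  have := Fintype.ofFinite ((W → Fin (r + 2)) × Fin 6)
  -- There are six pads per possible layer pattern `W → Fin (r + 2)`, so six pads have images with a
  -- common pattern `σ`.
  obtain ⟨σ, g, hg⟩ := exists_embedding_fiber (n := 6)
    (fun (s : (W → Fin (r + 2)) × Fin 6) w => (h (pad w s)).layer)
    (by rw [← Nat.card_eq_fintype_card, Nat.card_prod, Nat.card_eq_fintype_card (α := Fin 6),
      Fintype.card_fin])
  replace hg : ∀ i w, (h (pad w (g i))).layer = σ w := fun i w => congrFun (hg i) w
  have hdisj : ∀ {i j}, i ≠ j → ∀ w w', pad w (g i) ≠ pad w' (g j) := fun hij w w' he =>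
    hij (g.injective (hpad _ _ _ _ he))
  have hσ : ∀ w w', R (layW w) (layW w') ↔ R (σ w) (σ w') := by
    intro w w'
    by_contra hne
    -- Different pads are not adjacent before the flip, so a disagreement of `R` must be compensated
    -- by an edge between the images.
    have hadj : ∀ i j, i ≠ j →
        (subdividedBiclique r M).Adj (h (pad w (g i))) (h (pad w' (g j))) := by
      intro i j hij
      have h1 := hh _ _ (hdisj hij w w')
      have h2 := hfar (pad w (g i)) (g j) (hdisj hij w) w'
      rw [hlay, hlay, hg, hg] at h1
      unfold Xor at h1
      tauto
    -- Pads 0, 1, 2 against 3, 4, 5 would span a `K_{3,3}` in the subdivided biclique, making two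
    -- adjacent vertices native.
    refine not_adj_of_isNative hr ?_ ?_ (hadj 0 3 (by decide))
    · exact isNative_of_three_adj (hadj 0 3 (by decide)) (hadj 0 4 (by decide))
        (hadj 0 5 (by decide)) (hinj.ne (hdisj (by decide) _ _))
        (hinj.ne (hdisj (by decide) _ _)) (hinj.ne (hdisj (by decide) _ _))
    · exact isNative_of_three_adj (hadj 0 3 (by decide)).symm (hadj 1 3 (by decide)).symm
        (hadj 2 3 (by decide)).symm (hinj.ne (hdisj (by decide) _ _))
        (hinj.ne (hdisj (by decide) _ _)) (hinj.ne (hdisj (by decide) _ _))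
  have hpadadj : ∀ i w w', G₀.Adj (pad w (g i)) (pad w' (g i)) →
      (subdividedBiclique r M).Adj (h (pad w (g i))) (h (pad w' (g i))) := by
    intro i w w' hadj
    have h1 := hh _ _ hadj.ne
    rw [hlay, hlay, hg, hg] at h1
    exact (iff_of_xor_iff_xor h1 (hσ w w')).1 hadj
  have hab : ∀ v w, R (lay v) (layW w) ↔ R (h v).layer (σ w) := by
    intro v w
    by_contra hne
    -- The vertex `v` lies in at most one pad; the other pads are disjoint from it and not adjacent
    -- to it.
    obtain ⟨i₀, hi₀⟩ : ∃ i₀, ∀ i ≠ i₀, ∀ w, v ≠ pad w (g i) := by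
      by_cases hv : ∃ i w, v = pad w (g i)
      · obtain ⟨i, w, rfl⟩ := hv
        exact ⟨i, fun j hj w' => hdisj hj.symm w w'⟩
      · push Not at hv
        exact ⟨0, fun i _ => hv i⟩
    have hadj : ∀ i ≠ i₀, (subdividedBiclique r M).Adj (h v) (h (pad w (g i))) := by
      intro i hi
      have h1 := hh _ _ (hi₀ i hi w)
      have h2 := hfar v (g i) (hi₀ i hi) w
      rw [hlay, hg] at h1
      unfold Xor at h1
      tauto
    have three : ∀ i₀ : Fin 6, ∃ i j k : Fin 6, i ≠ i₀ ∧ j ≠ i₀ ∧ k ≠ i₀ ∧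
        i ≠ j ∧ i ≠ k ∧ j ≠ k := by decide
    obtain ⟨i, j, k, hi, hj, hk, hij, hik, hjk⟩ := three i₀
    refine not_adj_of_isNative hr ?_ ?_ (hadj i hi)
    · exact isNative_of_three_adj (hadj i hi) (hadj j hj) (hadj k hk)
        (hinj.ne (hdisj hij _ _)) (hinj.ne (hdisj hik _ _)) (hinj.ne (hdisj hjk _ _))
    -- The pad vertex keeps its two neighbours inside the pad, and the image of `v` is a third one.
    · obtain ⟨w₁, w₂, hw, h₁, h₂⟩ := hdeg w (g i)
      exact isNative_of_three_adj (hadj i hi).symm (hpadadj _ _ _ h₁) (hpadadj _ _ _ h₂)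
        (hinj.ne (hi₀ i hi _)) (hinj.ne (hi₀ i hi _)) (hinj.ne hw)
  rcases eq_or_ne u v with rfl | huv
  · simp
  · exact iff_of_xor_iff_xor (hh u v huv) (rel_iff_of_twin hR hlayW hσ hab u v)

end Rigidity

/-! ### The gadget graph -/

section Gadget

/-- Indices of the disjoint copies of the biclique of order `2` in the gadget graph. -/
abbrev PadIndex (r : ℕ) : Type := (BicliqueVertex r 2 → Fin (r + 2)) × Fin 6

/-- The kinds of vertices of the gadget graph: hubs represent the vertices of the encoded graph,
leaves mark the hubs, two arms with a common middle vertex represent an edge, and pads rigidify. -/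
inductive GadgetKind (r : ℕ) : Type
  | hub : GadgetKind r
  | leaf (s : Fin 3) : GadgetKind r
  | mid : GadgetKind r
  | arm (a : Fin 2) (p : Fin r) : GadgetKind r
  | pad (w : BicliqueVertex r 2) (s : PadIndex r) : GadgetKind r

/-- Labels for native vertices of the biclique that hosts the gadget graph. -/
inductive GadgetPort (r : ℕ) : Type
  | main : GadgetPort r
  | leaf (s : Fin 3) : GadgetPort r
  | arm (a : Fin 2) : GadgetPort r
  | pad (s : PadIndex r) (a : Fin 2) : GadgetPort r

instance (r : ℕ) : Finite (GadgetKind r) := by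
  let f : GadgetKind r → (Unit ⊕ Fin 3 ⊕ Unit) ⊕ (Fin 2 × Fin r) ⊕ (BicliqueVertex r 2 × PadIndex r)
    | .hub => .inl (.inl ())
    | .leaf s => .inl (.inr (.inl s))
    | .mid => .inl (.inr (.inr ()))
    | .arm a p => .inr (.inl (a, p))
    | .pad w s => .inr (.inr (w, s))
  refine Finite.of_injective f ?_
  rintro (_ | _ | _ | _ | _) (_ | _ | _ | _ | _) h <;> simp_all [f]

instance (r : ℕ) : Finite (GadgetPort r) := by
  let f : GadgetPort r → (Unit ⊕ Fin 3) ⊕ Fin 2 ⊕ (PadIndex r × Fin 2)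
    | .main => .inl (.inl ())
    | .leaf s => .inl (.inr s)
    | .arm a => .inr (.inl a)
    | .pad s a => .inr (.inr (s, a))
  refine Finite.of_injective f ?_
  rintro (_ | _ | _ | _) (_ | _ | _ | _) h <;> simp_all [f]

/-- The layer of the gadget vertices of a given kind. -/
def GadgetKind.layer {r : ℕ} (hr : 0 < r) : GadgetKind r → Fin (r + 2)
  | .hub => 0
  | .leaf _ => (⟨0, hr⟩ : Fin r).succ.castSucc
  | .mid => Fin.last _
  | .arm _ p => p.succ.castSucc
  | .pad w _ => w.layer

/-- A cell of the table of a graph on `Fin n`: an entry of the adjacency matrix, or the end of a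
row. -/
abbrev GridCell (n : ℕ) : Type := Fin n × Option (Fin n)

open Classical in
/-- The symbol at a cell of the table. -/
noncomputable def cellSymbol {n : ℕ} (H : SimpleGraph (Fin n)) (c : GridCell n) : Option Bool :=
  c.2.map fun j => decide (H.Adj c.1 j)

/-- What the adjacency of two gadget vertices depends on, besides their kinds. -/
structure CellFlags : Type where
  sym : Option Bool
  sym' : Option Bool
  row : Bool
  col : Bool
  tr : Bool
  dcol : Bool

/-- The flags for the opposite order of cells. -/
def CellFlags.swap (x : CellFlags) : CellFlags := ⟨x.sym', x.sym, x.row, x.col, x.dcol, x.tr⟩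

/-- The flags of two cells. -/
noncomputable def cellFlags {n : ℕ} (H : SimpleGraph (Fin n)) (c d : GridCell n) : CellFlags where
  sym := cellSymbol H c
  sym' := cellSymbol H d
  row := decide (c.1 = d.1)
  col := decide (c.2 = d.2)
  tr := decide (c.2 = some d.1)
  dcol := decide (d.2 = some c.1)

lemma cellFlags_swap {n : ℕ} (H : SimpleGraph (Fin n)) (c d : GridCell n) :
    (cellFlags H c d).swap = cellFlags H d c := by
  simp [cellFlags, CellFlags.swap, eq_comm]

variable {r n : ℕ}

/-- The number of native vertices on either side of the biclique that hosts the gadget graph. -/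
noncomputable def hostSize (r n : ℕ) : ℕ := Nat.card (GridCell n × GadgetPort r)

/-- The native vertex with a given label. -/
noncomputable def host (x : GridCell n × GadgetPort r) : Fin (hostSize r n) := Finite.equivFin _ x

@[simp] lemma host_inj {x y : GridCell n × GadgetPort r} : host x = host y ↔ x = y :=
  (Finite.equivFin _).injective.eq_iff

open Classical in
/-- The left vertex where an arm begins: one of the hubs if the arm belongs to an edge. -/
noncomputable def armAnchor (H : SimpleGraph (Fin n)) (c : GridCell n) (a : Fin 2) :
    GridCell n × GadgetPort r :=
  match c.2 with
  -- For a non-edge the anchor is a private left vertex that is not in the gadget graph, so the arm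
  -- dangles.
  | some j => if H.Adj c.1 j then ((if a = 0 then c.1 else j, none), .main) else (c, .arm a)
  | none => (c, .arm a)

/-- The place of the gadget vertices in the hosting biclique. -/
noncomputable def gadgetPlace (hr : 0 < r) (H : SimpleGraph (Fin n)) (c : GridCell n) :
    GadgetKind r → BicliqueVertex r (hostSize r n)
  | .hub => .left (host (c, .main))
  -- Outside end-of-row cells a leaf gets a private left end missing from the gadget graph and is
  -- isolated before the flip. This lets all cells carry the same kinds.
  | .leaf s => .inner (host (c, if c.2 = none then .main else .leaf s)) (host (c, .leaf s)) ⟨0, hr⟩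
  | .mid => .right (host (c, .main))
  | .arm a p => .inner (host (armAnchor H c a)) (host (c, .main)) p
  | .pad w s => w.map (fun a => host (c, .pad s a)) (fun b => host (c, .pad s b))

lemma layer_gadgetPlace (hr : 0 < r) (H : SimpleGraph (Fin n)) (c : GridCell n)
    (t : GadgetKind r) : (gadgetPlace hr H c t).layer = t.layer hr := by
  rcases t with _ | _ | _ | _ | w <;> simp [gadgetPlace, GadgetKind.layer, BicliqueVertex.layer]
  cases w <;> rfl

/-- The arms of an edge start at different hubs because the ends of an edge are distinct; other arms
have private ports. -/
lemma armAnchor_inj {H : SimpleGraph (Fin n)} {c : GridCell n} {a b : Fin 2} :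
    armAnchor (r := r) H c a = armAnchor H c b ↔ a = b := by
  refine ⟨fun h => ?_, fun h => h ▸ rfl⟩
  unfold armAnchor at h
  rcases c with ⟨i, _ | j⟩
  · simpa using h
  · simp only at h
    split_ifs at h with hij h1 h2 h2
    · rw [h1, h2]
    · simp [hij.ne] at h
    · simp [hij.ne'] at h
    · omega
    · simpa using h

lemma gadgetPlace_injective (hr : 0 < r) (H : SimpleGraph (Fin n)) :
    Function.Injective fun u : GridCell n × GadgetKind r => gadgetPlace hr H u.1 u.2 := by
  rintro ⟨c, t⟩ ⟨d, t'⟩ h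
  rcases t with _ | _ | _ | _ | ⟨_ | _ | _, _⟩ <;> rcases t' with _ | _ | _ | _ | ⟨_ | _ | _, _⟩ <;>
    simp [gadgetPlace, BicliqueVertex.map] at h ⊢ <;> try tauto
  obtain ⟨h1, rfl, rfl⟩ := h
  simpa [armAnchor_inj] using h1

/-- Whether a gadget vertex precedes another one, in terms of kinds and flags. -/
def GadgetKind.Next : GadgetKind r → GadgetKind r → CellFlags → Prop
  | .hub, .leaf _, x => x.row ∧ x.col ∧ x.sym = none
  | .hub, .arm a p, x =>
      x.sym = none ∧ x.sym' = some true ∧ (if a = 0 then x.row else x.dcol) ∧ (p : ℕ) = 0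
  | .arm a p, .arm b q, x => x.row ∧ x.col ∧ a = b ∧ (p : ℕ) + 1 = q
  | .arm _ p, .mid, x => x.row ∧ x.col ∧ (p : ℕ) + 1 = r
  | .pad w s, .pad w' s', x => x.row ∧ x.col ∧ s = s' ∧ w.Next w'
  | _, _, _ => False

/-- Reduces adjacency to finitely many flags, which is what makes gadgets functorial and printable
by a finite-state machine. -/
lemma next_gadgetPlace (hr : 0 < r) (H : SimpleGraph (Fin n)) (c d : GridCell n)
    (t t' : GadgetKind r) :
    (gadgetPlace hr H c t).Next (gadgetPlace hr H d t') ↔ t.Next t' (cellFlags H c d) := by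
  obtain ⟨i, o⟩ := c
  obtain ⟨i', o'⟩ := d
  rcases t with _ | _ | _ | _ | ⟨_ | _ | _, _⟩ <;> rcases t' with _ | _ | _ | _ | ⟨_ | _ | _, _⟩ <;>
    simp [gadgetPlace, BicliqueVertex.map, BicliqueVertex.Next, GadgetKind.Next, cellFlags,
      cellSymbol, hr.ne']
  · rw [and_assoc]
    exact and_congr_right fun _ => and_congr_right fun h => by rw [h]
  · rename_i a p
    rw [← and_assoc, ← and_assoc]
    refine and_congr_left fun _ => ?_
    unfold armAnchor
    rcases o' with _ | j'
    · simp
    · by_cases hH : H.Adj i' j' <;> by_cases ha : a = 0 <;> simp [hH, ha, eq_comm, and_comm]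
  · rw [and_assoc]
  · rw [and_left_comm, and_assoc]
    refine and_congr_right fun hi => and_congr_right fun ho => ?_
    subst hi ho
    rw [armAnchor_inj]
  · intro _ _
    split_ifs <;> simp
  · unfold armAnchor
    rcases o' with _ | j'
    · simp
    · by_cases hH : H.Adj i' j' <;> simp [hH]
  all_goals tauto

/-- The graph that encodes `H`, for the flip given by `R`. -/
noncomputable def gadgetGraph (hr : 0 < r) (R : Fin (r + 2) → Fin (r + 2) → Prop)
    (hR : ∀ a b, R a b → R b a) (H : SimpleGraph (Fin n)) :
    SimpleGraph (GridCell n × GadgetKind r) :=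
  (layerFlip R hR (hostSize r n)).comap fun u => gadgetPlace hr H u.1 u.2

/-- The gadget graph is an induced subgraph of the flipped biclique. -/
noncomputable def gadgetGraphEmbedding (hr : 0 < r) (R : Fin (r + 2) → Fin (r + 2) → Prop)
    (hR : ∀ a b, R a b → R b a) (H : SimpleGraph (Fin n)) :
    gadgetGraph hr R hR H ↪g layerFlip R hR (hostSize r n) where
  toFun u := gadgetPlace hr H u.1 u.2
  inj' := gadgetPlace_injective hr H
  map_rel_iff' := Iff.rfl

/-- Adjacency in the gadget graph, in terms of kinds and flags. -/
def GadgetKind.Linked (hr : 0 < r) (R : Fin (r + 2) → Fin (r + 2) → Prop) (t t' : GadgetKind r)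
    (x : CellFlags) : Prop :=
  ¬ (x.row ∧ x.col ∧ t = t') ∧
    Xor (t.Next t' x ∨ t'.Next t x.swap) (R (t.layer hr) (t'.layer hr))

lemma adj_gadgetPlace (hr : 0 < r) (H : SimpleGraph (Fin n)) (c d : GridCell n)
    (t t' : GadgetKind r) :
    (subdividedBiclique r _).Adj (gadgetPlace hr H c t) (gadgetPlace hr H d t') ↔
      t.Next t' (cellFlags H c d) ∨ t'.Next t (cellFlags H d c) := by
  rw [subdividedBiclique_adj, next_gadgetPlace, next_gadgetPlace]

lemma gadgetGraph_adj_iff_place (hr : 0 < r) (R : Fin (r + 2) → Fin (r + 2) → Prop)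
    (hR : ∀ a b, R a b → R b a) (H : SimpleGraph (Fin n)) (u v : GridCell n × GadgetKind r) :
    (gadgetGraph hr R hR H).Adj u v ↔ u ≠ v ∧
      Xor ((subdividedBiclique r _).Adj (gadgetPlace hr H u.1 u.2) (gadgetPlace hr H v.1 v.2))
        (R (u.2.layer hr) (v.2.layer hr)) := by
  rw [gadgetGraph, SimpleGraph.comap_adj]
  simp only [layerFlip, layer_gadgetPlace]
  exact and_congr_left fun _ => (gadgetPlace_injective hr H).ne_iff

lemma gadgetGraph_adj (hr : 0 < r) (R : Fin (r + 2) → Fin (r + 2) → Prop)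
    (hR : ∀ a b, R a b → R b a) (H : SimpleGraph (Fin n)) (u v : GridCell n × GadgetKind r) :
    (gadgetGraph hr R hR H).Adj u v ↔ u.2.Linked hr R v.2 (cellFlags H u.1 v.1) := by
  rw [gadgetGraph_adj_iff_place, adj_gadgetPlace, GadgetKind.Linked, cellFlags_swap]
  refine and_congr_left fun _ => not_congr ?_
  rw [Prod.ext_iff, Prod.ext_iff, and_assoc]
  simp [cellFlags]

lemma cellFlags_map {m : ℕ} {K : SimpleGraph (Fin m)} {H : SimpleGraph (Fin n)} (e : K ↪g H)
    (c d : GridCell m) :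
    cellFlags H (e c.1, c.2.map e) (e d.1, d.2.map e) = cellFlags K c d := by
  have h : ∀ c : GridCell m, cellSymbol H (e c.1, c.2.map e) = cellSymbol K c := by
    rintro ⟨i, _ | j⟩ <;> simp [cellSymbol]
  have h' : ∀ (o : Option (Fin m)) (i : Fin m), o.map e = some (e i) ↔ o = some i := by
    rintro (_ | _) _ <;> simp
  have h'' : ∀ o o' : Option (Fin m), o.map e = o'.map e ↔ o = o' := fun o o' =>
    (Option.map_injective e.injective).eq_iff
  simp only [cellFlags, h, h', h'', e.injective.eq_iff]

/-- Gadget graphs are functorial for embeddings. -/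
noncomputable def gadgetGraphMap (hr : 0 < r) (R : Fin (r + 2) → Fin (r + 2) → Prop)
    (hR : ∀ a b, R a b → R b a) {m : ℕ} {K : SimpleGraph (Fin m)} {H : SimpleGraph (Fin n)}
    (e : K ↪g H) : gadgetGraph hr R hR K ↪g gadgetGraph hr R hR H where
  toFun u := ((e u.1.1, u.1.2.map e), u.2)
  inj' := by
    rintro ⟨⟨i, o⟩, t⟩ ⟨⟨i', o'⟩, t'⟩ h
    simpa [(Option.map_injective e.injective).eq_iff] using h
  map_rel_iff' {u v} := by
    rw [gadgetGraph_adj, gadgetGraph_adj, ← cellFlags_map e u.1 v.1]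
    rfl

/-- The vertex of the gadget graph that represents `i`. -/
def gadgetHub (i : Fin n) : GridCell n × GadgetKind r := ((i, none), .hub)

/-- Order 2 suffices to give native vertices two neighbours; this is the degree condition on pads.
-/
lemma exists_two_adj (hr : 0 < r) (w : BicliqueVertex r 2) : ∃ w₁ w₂, w₁ ≠ w₂ ∧
    (subdividedBiclique r 2).Adj w w₁ ∧ (subdividedBiclique r 2).Adj w w₂ := by
  simp only [subdividedBiclique_adj]
  rcases w with a | b | ⟨a, b, p⟩
  · exact ⟨.inner a 0 ⟨0, hr⟩, .inner a 1 ⟨0, hr⟩, by simp, by simp [BicliqueVertex.Next],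
      by simp [BicliqueVertex.Next]⟩
  · exact ⟨.inner 0 b ⟨r - 1, by omega⟩, .inner 1 b ⟨r - 1, by omega⟩, by simp,
      .inr ⟨rfl, by simp; omega⟩, .inr ⟨rfl, by simp; omega⟩⟩
  · have h1 : ∃ w : BicliqueVertex r 2, w.Next (.inner a b p) := by
      by_cases hp : (p : ℕ) = 0
      · exact ⟨.left a, rfl, hp⟩
      · exact ⟨.inner a b ⟨p - 1, by omega⟩, rfl, rfl, by simp; omega⟩
    have h2 : ∃ w, (BicliqueVertex.inner a b p).Next w := by
      by_cases hp : (p : ℕ) + 1 = r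
      · exact ⟨.right b, rfl, hp⟩
      · exact ⟨.inner a b ⟨p + 1, by omega⟩, rfl, rfl, rfl⟩
    obtain ⟨w₁, h1⟩ := h1
    obtain ⟨w₂, h2⟩ := h2
    refine ⟨w₁, w₂, ?_, .inr h1, .inl h2⟩
    rintro rfl
    rcases w₁ with _ | _ | ⟨_, _, q⟩ <;> simp only [BicliqueVertex.Next] at h1 h2
    omega

/-! ### Induced embeddings between gadget graphs -/

variable {m : ℕ} {hr : 0 < r} {R : Fin (r + 2) → Fin (r + 2) → Prop} {hR : ∀ a b, R a b → R b a}
  {K : SimpleGraph (Fin m)} {H : SimpleGraph (Fin n)}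

/-- Embeddings of gadget graphs preserve the adjacencies before the flip. -/
lemma adj_gadgetPlace_map (h : gadgetGraph hr R hR K ↪g gadgetGraph hr R hR H) (z : Fin m)
    (u v : GridCell m × GadgetKind r) :
    (subdividedBiclique r _).Adj (gadgetPlace hr K u.1 u.2) (gadgetPlace hr K v.1 v.2) ↔
      (subdividedBiclique r _).Adj (gadgetPlace hr H (h u).1 (h u).2)
        (gadgetPlace hr H (h v).1 (h v).2) := by
  -- The pads of one cell suffice; `z` only serves to name a cell.
  refine adj_iff_of_flip_embedding hr hR
    (G₀ := (subdividedBiclique r _).comap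
      fun u : GridCell m × GadgetKind r => gadgetPlace hr K u.1 u.2)
    (lay := fun u => u.2.layer hr) (h := fun u => gadgetPlace hr H (h u).1 (h u).2)
    ((gadgetPlace_injective hr H).comp h.injective) (fun u v huv => ?_)
    (layW := BicliqueVertex.layer (n := 2)) (BicliqueVertex.layer_surjective (by norm_num))
    (pad := fun w s => ((z, none), .pad w s)) ?_ ?_ ?_ ?_ u v
  · have h1 := h.map_adj_iff (v := u) (w := v)
    rw [gadgetGraph_adj_iff_place, gadgetGraph_adj_iff_place, and_iff_right huv,
      and_iff_right (h.injective.ne huv)] at h1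
    simp only [SimpleGraph.comap_adj, layer_gadgetPlace]
    exact h1.symm
  · rintro w s w' s' h
    simp only [Prod.mk.injEq, GadgetKind.pad.injEq, true_and] at h
    exact h.2
  · intro w s
    rfl
  · rintro ⟨c, t⟩ s hv w hadj
    rw [SimpleGraph.comap_adj, adj_gadgetPlace] at hadj
    rcases t with _ | _ | _ | _ | ⟨w', s'⟩ <;> simp [GadgetKind.Next, cellFlags] at hadj
    refine hv w' ?_
    rcases hadj with ⟨h1, h2, rfl, -⟩ | ⟨h1, h2, rfl, -⟩ <;> simp [Prod.ext_iff, h1, h2]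
  · intro w s
    obtain ⟨w₁, w₂, hne, h₁, h₂⟩ := exists_two_adj hr w
    refine ⟨w₁, w₂, by simpa using hne, ?_⟩
    simp only [SimpleGraph.comap_adj, adj_gadgetPlace]
    rw [subdividedBiclique_adj] at h₁ h₂
    simpa [GadgetKind.Next, cellFlags] using ⟨h₁, h₂⟩

/-- Only hubs have three neighbours before the flip. -/
lemma exists_hub_of_three_adj {v a b c : GridCell n × GadgetKind r}
    (ha : (subdividedBiclique r _).Adj (gadgetPlace hr H v.1 v.2) (gadgetPlace hr H a.1 a.2))
    (hb : (subdividedBiclique r _).Adj (gadgetPlace hr H v.1 v.2) (gadgetPlace hr H b.1 b.2))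
    (hc : (subdividedBiclique r _).Adj (gadgetPlace hr H v.1 v.2) (gadgetPlace hr H c.1 c.2))
    (hab : a ≠ b) (hac : a ≠ c) (hbc : b ≠ c) : ∃ i, v = gadgetHub i := by
  have hnat := isNative_of_three_adj ha hb hc ((gadgetPlace_injective hr H).ne hab)
    ((gadgetPlace_injective hr H).ne hac) ((gadgetPlace_injective hr H).ne hbc)
  obtain ⟨cell, t⟩ := v
  rw [adj_gadgetPlace] at ha hb hc
  -- Middle vertices and native pad vertices have at most two neighbours. Inner vertices are
  -- excluded by `hnat`, and hubs outside end-of-row cells have no neighbours.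
  have two : ∀ f : Fin 2 → GridCell n × GadgetKind r, (∃ x, a = f x) → (∃ x, b = f x) →
      (∃ x, c = f x) → False := by
    rintro f ⟨x, rfl⟩ ⟨y, rfl⟩ ⟨z, rfl⟩
    have hxy := ne_of_apply_ne f hab
    have hxz := ne_of_apply_ne f hac
    have hyz := ne_of_apply_ne f hbc
    omega
  rcases t with _ | _ | _ | _ | ⟨x | x | _, s⟩
  · obtain ⟨i, o⟩ := cell
    obtain ⟨d, t⟩ := a
    have : o = none := by
      rcases t with _ | _ | _ | _ | _ <;> simp [GadgetKind.Next, cellFlags, cellSymbol] at ha <;>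
        tauto
    exact ⟨i, by rw [this]; rfl⟩
  · exact hnat.elim
  · have key : ∀ u : GridCell n × GadgetKind r,
        GadgetKind.Next .mid u.2 (cellFlags H cell u.1) ∨
          u.2.Next .mid (cellFlags H u.1 cell) →
        ∃ x : Fin 2, u = (cell, .arm x ⟨r - 1, by omega⟩) := by
      rintro ⟨d, t⟩ h
      rcases t with _ | _ | _ | ⟨x, p⟩ | _ <;> simp [GadgetKind.Next, cellFlags] at h
      refine ⟨x, ?_⟩
      simp [Prod.ext_iff, h, Fin.ext_iff]
      omega
    exact (two _ (key a ha) (key b hb) (key c hc)).elim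
  · exact hnat.elim
  · have key : ∀ u : GridCell n × GadgetKind r,
        GadgetKind.Next (.pad (.left x) s) u.2 (cellFlags H cell u.1) ∨
          u.2.Next (.pad (.left x) s) (cellFlags H u.1 cell) →
        ∃ y : Fin 2, u = (cell, .pad (.inner x y ⟨0, hr⟩) s) := by
      rintro ⟨d, t⟩ h
      rcases t with _ | _ | _ | _ | ⟨_ | _ | ⟨x', y, p⟩, s'⟩ <;>
        simp [GadgetKind.Next, cellFlags, BicliqueVertex.Next, hr.ne'] at h
      refine ⟨y, ?_⟩
      simp [Prod.ext_iff, h, Fin.ext_iff]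
    exact (two _ (key a ha) (key b hb) (key c hc)).elim
  · have key : ∀ u : GridCell n × GadgetKind r,
        GadgetKind.Next (.pad (.right x) s) u.2 (cellFlags H cell u.1) ∨
          u.2.Next (.pad (.right x) s) (cellFlags H u.1 cell) →
        ∃ y : Fin 2, u = (cell, .pad (.inner y x ⟨r - 1, by omega⟩) s) := by
      rintro ⟨d, t⟩ h
      rcases t with _ | _ | _ | _ | ⟨_ | _ | ⟨y, x', p⟩, s'⟩ <;>
        simp [GadgetKind.Next, cellFlags, BicliqueVertex.Next, hr.ne'] at h
      refine ⟨y, ?_⟩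
      simp [Prod.ext_iff, h, Fin.ext_iff]
      omega
    exact (two _ (key a ha) (key b hb) (key c hc)).elim
  · exact hnat.elim

/-- Embeddings of gadget graphs map hubs to hubs. -/
lemma exists_hub_map (h : gadgetGraph hr R hR K ↪g gadgetGraph hr R hR H) (k : Fin m) :
    ∃ i, h (gadgetHub k) = gadgetHub i := by
  have hadj : ∀ s, (subdividedBiclique r _).Adj
      (gadgetPlace hr H (h (gadgetHub k)).1 (h (gadgetHub k)).2)
      (gadgetPlace hr H (h ((k, none), .leaf s)).1 (h ((k, none), .leaf s)).2) := by
    intro s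
    rw [← adj_gadgetPlace_map h k, adj_gadgetPlace]
    simp [gadgetHub, GadgetKind.Next, cellFlags, cellSymbol]
  have hne : ∀ s s', s ≠ s' → h ((k, none), .leaf s) ≠ h ((k, none), .leaf s') := by
    intro s s' hs
    simpa using hs
  exact exists_hub_of_three_adj (hadj 0) (hadj 1) (hadj 2) (hne _ _ (by decide))
    (hne _ _ (by decide)) (hne _ _ (by decide))

/-- The vertices along an arm, from the hub to the middle vertex. -/
def armPath (k : Fin n) (c : GridCell n) (a : Fin 2) : ℕ → GridCell n × GadgetKind r
  | 0 => gadgetHub k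
  | t + 1 => if ht : t < r then (c, .arm a ⟨t, ht⟩) else (c, .mid)

/-- The image of an arm of an edge is an arm that begins at the image of its hub. -/
lemma exists_arm_map (h : gadgetGraph hr R hR K ↪g gadgetGraph hr R hR H) {k k' : Fin m}
    (hK : K.Adj k k') {a : Fin 2} {i : Fin n}
    (hi : h (gadgetHub (if a = 0 then k else k')) = gadgetHub i) :
    ∃ (c : GridCell n) (b : Fin 2), armAnchor (r := r) H c b = ((i, none), .main) ∧
      gadgetPlace hr H (h ((k, some k'), .mid)).1 (h ((k, some k'), .mid)).2 =
        .right (host (c, .main)) := by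
  let path : ℕ → GridCell m × GadgetKind r := armPath (if a = 0 then k else k') (k, some k') a
  let q : ℕ → BicliqueVertex r (hostSize r n) := fun t =>
    gadgetPlace hr H (h (path t)).1 (h (path t)).2
  have h0 : q 0 = .left (host ((i, none), .main)) := by
    simp only [q, path, armPath, hi]
    rfl
  have hadj : ∀ t < r + 1, (subdividedBiclique r _).Adj (q t) (q (t + 1)) := by
    intro t ht
    simp only [q]
    rw [← adj_gadgetPlace_map h k, adj_gadgetPlace]
    rcases t with _ | t
    · left
      have ha : a = 0 ∨ a = 1 := by omega
      rcases ha with rfl | rfl <;>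
        simp [path, armPath, hr, gadgetHub, GadgetKind.Next, cellFlags, cellSymbol, hK]
    · left
      have ht : t < r := by omega
      by_cases ht' : t + 1 < r
      · simp [path, armPath, ht, ht', GadgetKind.Next, cellFlags]
      · simp [path, armPath, ht, ht', GadgetKind.Next, cellFlags]
        omega
  have hne : ∀ t, t + 2 ≤ r + 1 → q t ≠ q (t + 2) := by
    intro t ht
    refine ((gadgetPlace_injective hr H).comp h.injective).ne ?_
    rcases t with _ | t
    · by_cases h1 : 1 < r <;> simp [path, armPath, gadgetHub, h1]
    · have ht : t < r := by omega
      by_cases ht' : t + 2 < r <;> simp [path, armPath, ht, ht']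
  obtain ⟨y, hy1, hy2⟩ := path_from_left hr h0 hadj hne
  have hp1 : path 1 = ((k, some k'), .arm a ⟨0, hr⟩) := by simp [path, armPath, hr]
  have hp2 : path (r + 1) = ((k, some k'), .mid) := by simp [path, armPath]
  simp only [q, hp1, hp2] at hy1 hy2
  generalize h ((k, some k'), .arm a ⟨0, hr⟩) = u at hy1
  rw [hy2]
  generalize h ((k, some k'), .mid) = v at hy2
  obtain ⟨c, t⟩ := u
  obtain ⟨d, t'⟩ := v
  -- Only leaves and arms can follow a hub. The path through a leaf would end in a right vertex
  -- missing from the gadget graph.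
  rcases t with _ | s | _ | ⟨b, p⟩ | ⟨_ | _ | ⟨_, _, _⟩, s⟩ <;>
    simp [gadgetPlace, BicliqueVertex.map] at hy1
  · obtain ⟨-, rfl, -⟩ := hy1
    rcases t' with _ | _ | _ | _ | ⟨_ | _ | _, _⟩ <;>
      simp [gadgetPlace, BicliqueVertex.map] at hy2
  · obtain ⟨h1, rfl, -⟩ := hy1
    exact ⟨c, b, h1, rfl⟩

/-- Embeddings of gadget graphs map edges to edges. -/
lemma adj_of_hub_map (h : gadgetGraph hr R hR K ↪g gadgetGraph hr R hR H) {k k' : Fin m}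
    (hK : K.Adj k k') {i j : Fin n} (hi : h (gadgetHub k) = gadgetHub i)
    (hj : h (gadgetHub k') = gadgetHub j) : H.Adj i j := by
  have hij : i ≠ j := by
    rintro rfl
    have := h.injective (hi.trans hj.symm)
    simp only [gadgetHub, Prod.mk.injEq, and_true] at this
    exact hK.ne this
  obtain ⟨c, a, h1, h2⟩ := exists_arm_map h hK (a := 0) (i := i) (by simpa using hi)
  obtain ⟨d, b, h3, h4⟩ := exists_arm_map h hK (a := 1) (i := j) (by simpa using hj)
  -- Both arms end at the image of the same middle vertex, so they belong to one cell. As `i ≠ j`,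
  -- they are its two arms and that cell is an edge of `H`.
  have hcd := h2.symm.trans h4
  simp only [BicliqueVertex.right.injEq, host_inj, Prod.mk.injEq, and_true] at hcd
  subst hcd
  obtain ⟨x, _ | y⟩ := c
  · simp [armAnchor] at h1
  · by_cases hH : H.Adj x y
    · simp only [armAnchor, hH, if_true, Prod.mk.injEq, and_true] at h1 h3
      subst h1 h3
      have ha : a = 0 ∨ a = 1 := by omega
      have hb : b = 0 ∨ b = 1 := by omega
      rcases ha with rfl | rfl <;> rcases hb with rfl | rfl <;> simp_all [H.adj_comm]
    · simp [armAnchor, hH] at h1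

end Gadget

/-! ### Sweeping machines -/

section Sweep

/-- Process a list from left to right with an internal state. -/
def sweepState {Q A : Type} (f : Q → A → Q) (q : Q) (l : List A) : Q := l.foldl f q

/-- The outputs of processing a list from left to right with an internal state. -/
def sweepMap {Q A B : Type} (f : Q → A → Q) (g : Q → A → B) : Q → List A → List B
  | _, [] => []
  | q, x :: l => g q x :: sweepMap f g (f q x) l

/-- A machine that reads its input into a list of cells and then repeatedly sweeps over this list,
rewriting each of the cells and printing a block of `m + 1` bits for each of them. -/
structure SweepMachine where
  (Q Cell : Type)
  [finiteQ : Finite Q]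
  [inhabitedCell : Inhabited Cell]
  m : ℕ
  /-- The initial state. -/
  init : Q
  /-- The state after reading an input symbol. -/
  readState : Q → Option Bool → Q
  /-- The cell that represents an input symbol. -/
  readCell : Q → Option Bool → Cell
  /-- Whether there is another sweep to do. -/
  alive : Q → Bool
  /-- The state after a sweep passes a cell. -/
  next : Q → Cell → Q
  /-- The new contents of a cell. -/
  write : Q → Cell → Cell
  /-- The bits printed at a cell. -/
  bits : Q → Cell → Fin (m + 1) → Bool
  /-- The update of the state at the end of a pass. -/
  turn : Q → Q
  [finiteCell : Finite Cell]

attribute [instance] SweepMachine.finiteQ SweepMachine.inhabitedCell SweepMachine.finiteCell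

namespace SweepMachine

variable (S : SweepMachine)

/-- The configuration between two sweeps: the state, the cells and the output. -/
abbrev Conf : Type := S.Q × List S.Cell × List (Option Bool)

/-- The block printed at a cell. -/
def block (q : S.Q) (c : S.Cell) : List (Option Bool) :=
  (List.finRange (S.m + 1)).map fun t => some (S.bits q c t)

/-- The configuration after reading the input. -/
def start (w : List (Option Bool)) : S.Conf :=
  (S.turn (sweepState S.readState S.init w), sweepMap S.readState S.readCell S.init w, [])

/-- The effect of one sweep. -/
def sweep (x : S.Conf) : S.Conf :=
  (S.turn (sweepState S.next x.1 x.2.1), sweepMap S.next S.write x.1 x.2.1,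
    -- The output is a stack listed from its top: later blocks come first, and the separator pushed
    -- before a row ends up after it.
    (sweepMap S.next S.block x.1 x.2.1).reverse.flatten ++ none :: x.2.2)

/-- The tapes of the Turing machine. -/
inductive Stack : Type
  | inp | left | right | out
  deriving DecidableEq

/-- The labels of the Turing machine. -/
inductive Label : Type
  | read | back | forth | clean
  deriving DecidableEq

instance : Fintype Stack where
  elems := {.inp, .left, .right, .out}
  complete := by rintro (_ | _ | _ | _) <;> decide

instance : Fintype Label where
  elems := {.read, .back, .forth, .clean}
  complete := by rintro (_ | _ | _ | _) <;> decide

/-- The alphabets of the tapes. -/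
def Alphabet : Stack → Type
  | .inp => Option Bool
  | .left => S.Cell
  | .right => S.Cell
  | .out => Option Bool

/-- The registers of the Turing machine: the state and the last symbols popped. -/
abbrev Reg : Type := S.Q × Option (Option Bool) × Option S.Cell

/-- The statements of the Turing machine. -/
abbrev Stmt : Type := Turing.TM2.Stmt S.Alphabet Label S.Reg

/-- Printing a block. -/
def printBlock : List (Fin (S.m + 1)) → S.Stmt → S.Stmt
  | [], q => q
  -- The head is pushed last, so the block reads forwards from the top of the stack.
  | t :: ts, q => printBlock ts
      (.push .out (fun s : S.Reg => (some (S.bits s.1 (s.2.2.getD default) t) : Option Bool)) q)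

/-- The program of the Turing machine. -/
def program : Label → S.Stmt
  | .read => .pop .inp (fun s (x : Option (Option Bool)) => (s.1, x, s.2.2))
      (.branch (fun s => s.2.1.isSome)
        (.push .right (fun s => S.readCell s.1 (s.2.1.getD none))
          (.load (fun s => (S.readState s.1 (s.2.1.getD none), s.2)) (.goto fun _ => .read)))
        (.load (fun s => (S.turn s.1, s.2)) (.goto fun _ => .back)))
  | .back => .pop .right (fun s (x : Option S.Cell) => (s.1, s.2.1, x))
      (.branch (fun s => s.2.2.isSome)
        (.push .left (fun s => (s.2.2.getD default : S.Cell)) (.goto fun _ => .back))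
        (.branch (fun s => S.alive s.1)
          (.push .out (fun _ => (none : Option Bool)) (.goto fun _ => .forth))
          (.goto fun _ => .clean)))
  | .forth => .pop .left (fun s (x : Option S.Cell) => (s.1, s.2.1, x))
      (.branch (fun s => s.2.2.isSome)
        (.push .right (fun s => S.write s.1 (s.2.2.getD default))
          (S.printBlock (List.finRange _)
            (.load (fun s => (S.next s.1 (s.2.2.getD default), s.2)) (.goto fun _ => .forth))))
        (.load (fun s => (S.turn s.1, s.2)) (.goto fun _ => .back)))
  -- A halting configuration must have empty work stacks and initial registers.
  | .clean => .pop .left (fun s (x : Option S.Cell) => (s.1, s.2.1, x))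
      (.branch (fun s => s.2.2.isSome) (.goto fun _ => .clean)
        (.load (fun _ => (S.init, none, none)) .halt))

/-- The Turing machine. -/
noncomputable def machine : Turing.FinTM2 where
  K := Stack
  k₀ := .inp
  k₁ := .out
  Γ := S.Alphabet
  Λ := Label
  main := .read
  σ := S.Reg
  initialState := (S.init, none, none)
  σFin := Fintype.ofFinite _
  Γk₀Fin := inferInstanceAs (Fintype (Option Bool))
  m := S.program

/-! ### Correctness and running time of sweeping machines -/

variable {S}

/-- The contents of the tapes. -/
def tapes (i : List (Option Bool)) (a b : List S.Cell) (o : List (Option Bool)) :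
    ∀ k, List (S.Alphabet k)
  | .inp => i
  | .left => a
  | .right => b
  | .out => o

section Stacks

variable (i o o' : List (Option Bool)) (a a' b b' : List S.Cell)

@[simp] lemma update_left : Function.update (tapes i a b o) .left a' = tapes i a' b o := by
  funext k; cases k <;> rfl

@[simp] lemma update_right : Function.update (tapes i a b o) .right b' = tapes i a b' o := by
  funext k; cases k <;> rfl

@[simp] lemma update_out : Function.update (tapes i a b o) .out o' = tapes i a b o' := by
  funext k; cases k <;> rfl

end Stacks

/-- The machine goes from one configuration to another one in exactly `k` steps. -/
def StepsTo (k : ℕ) (x y : Turing.TM2.Cfg S.Alphabet Label S.Reg) : Prop :=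
  (flip bind (Turing.TM2.step S.program))^[k] (some x) = some y

lemma StepsTo.trans {k l : ℕ} {x y z : Turing.TM2.Cfg S.Alphabet Label S.Reg}
    (h : StepsTo k x y) (h' : StepsTo l y z) : StepsTo (k + l) x z := by
  unfold StepsTo at *
  rw [Nat.add_comm, Function.iterate_add_apply, h, h']

lemma StepsTo.single {l : Label} {s : S.Reg} {T : ∀ k, List (S.Alphabet k)}
    {y : Turing.TM2.Cfg S.Alphabet Label S.Reg}
    (h : Turing.TM2.stepAux (S.program l) s T = y) : StepsTo 1 ⟨some l, s, T⟩ y := by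
  subst h
  rfl

lemma stepAux_printBlock (ts : List (Fin (S.m + 1))) (q : S.Stmt) (s : S.Reg)
    (i o : List (Option Bool)) (a b : List S.Cell) :
    Turing.TM2.stepAux (S.printBlock ts q) s (tapes i a b o) =
      Turing.TM2.stepAux q s (tapes i a b
        ((ts.map fun t => some (S.bits s.1 (s.2.2.getD default) t)) ++ o)) := by
  induction ts generalizing q with
  | nil => rfl
  | cons t ts ih =>
    rw [printBlock, ih]
    simp only [Turing.TM2.stepAux, List.map_cons, List.cons_append]
    exact congrArg _ (update_out _ _ _ _ _)

lemma stepsTo_read (w : List (Option Bool)) (q : S.Q) (x : Option (Option Bool))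
    (y : Option S.Cell) (b : List S.Cell) :
    StepsTo (w.length + 1) ⟨some .read, (q, x, y), tapes w [] b []⟩
      ⟨some .back, (S.turn (sweepState S.readState q w), none, y),
        tapes [] [] ((sweepMap S.readState S.readCell q w).reverse ++ b) []⟩ := by
  induction w generalizing q x b with
  | nil =>
    exact .single (congrArg (Turing.TM2.Cfg.mk _ _) (funext fun k => by cases k <;> rfl))
  | cons c w ih =>
    rw [List.length_cons, Nat.add_comm _ 1]
    have h : StepsTo 1 ⟨some .read, (q, x, y), tapes (c :: w) [] b []⟩
        ⟨some .read, (S.readState q c, some c, y), tapes w [] (S.readCell q c :: b) []⟩ :=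
      .single (congrArg (Turing.TM2.Cfg.mk _ _) (funext fun k => by cases k <;> rfl))
    refine h.trans ?_
    simpa [sweepState, sweepMap] using ih (S.readState q c) (some c) (S.readCell q c :: b)

lemma stepsTo_back (q : S.Q) (x : Option (Option Bool)) (y : Option S.Cell) (a b : List S.Cell)
    (o : List (Option Bool)) :
    StepsTo (b.length + 1) ⟨some .back, (q, x, y), tapes [] a b o⟩
      (if S.alive q then ⟨some .forth, (q, x, none), tapes [] (b.reverse ++ a) [] (none :: o)⟩
      else ⟨some .clean, (q, x, none), tapes [] (b.reverse ++ a) [] o⟩) := by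
  induction b generalizing y a with
  | nil =>
    refine .single ?_
    by_cases hq : S.alive q
    · rw [if_pos hq]
      change cond (S.alive q) _ _ = _
      rw [hq]
      exact congrArg (Turing.TM2.Cfg.mk _ _) (funext fun k => by cases k <;> rfl)
    · rw [if_neg hq]
      change cond (S.alive q) _ _ = _
      rw [Bool.eq_false_of_not_eq_true hq]
      exact congrArg (Turing.TM2.Cfg.mk _ _) (funext fun k => by cases k <;> rfl)
  | cons c b ih =>
    rw [List.length_cons, Nat.add_comm _ 1]
    have h : StepsTo 1 ⟨some .back, (q, x, y), tapes [] a (c :: b) o⟩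
        ⟨some .back, (q, x, some c), tapes [] (c :: a) b o⟩ :=
      .single (congrArg (Turing.TM2.Cfg.mk _ _) (funext fun k => by cases k <;> rfl))
    refine h.trans ?_
    simpa using ih (some c) (c :: a)

lemma stepsTo_forth (q : S.Q) (x : Option (Option Bool)) (y : Option S.Cell) (a b : List S.Cell)
    (o : List (Option Bool)) :
    StepsTo (a.length + 1) ⟨some .forth, (q, x, y), tapes [] a b o⟩
      ⟨some .back, (S.turn (sweepState S.next q a), x, none),
        tapes [] [] ((sweepMap S.next S.write q a).reverse ++ b)
          ((sweepMap S.next S.block q a).reverse.flatten ++ o)⟩ := by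
  induction a generalizing q y b o with
  | nil =>
    exact .single (congrArg (Turing.TM2.Cfg.mk _ _) (funext fun k => by cases k <;> rfl))
  | cons c a ih =>
    rw [List.length_cons, Nat.add_comm _ 1]
    have h : StepsTo 1 ⟨some .forth, (q, x, y), tapes [] (c :: a) b o⟩
        ⟨some .forth, (S.next q c, x, some c),
          tapes [] a (S.write q c :: b) (S.block q c ++ o)⟩ := by
      have hT : Function.update (Function.update (tapes [] (c :: a) b o) .left a) .right
          (S.write q c :: b) = tapes [] a (S.write q c :: b) o := by
        rw [update_left]
        exact update_right _ _ _ _ _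
      refine .single (Eq.trans (congrArg (fun T => Turing.TM2.stepAux
        (S.printBlock (List.finRange _) (.load (fun s => (S.next s.1 (s.2.2.getD default), s.2))
          (.goto fun _ => .forth))) (q, x, some c) T) hT) ?_)
      rw [stepAux_printBlock]
      rfl
    refine h.trans ?_
    simpa [sweepState, sweepMap] using ih (S.next q c) (some c) (S.write q c :: b)
      (S.block q c ++ o)

lemma stepsTo_clean (q : S.Q) (x : Option (Option Bool)) (y : Option S.Cell) (a : List S.Cell)
    (o : List (Option Bool)) :
    StepsTo (a.length + 1) ⟨some .clean, (q, x, y), tapes [] a [] o⟩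
      ⟨none, (S.init, none, none), tapes [] [] [] o⟩ := by
  induction a generalizing y with
  | nil =>
    exact .single (congrArg (Turing.TM2.Cfg.mk _ _) (funext fun k => by cases k <;> rfl))
  | cons c a ih =>
    rw [List.length_cons, Nat.add_comm _ 1]
    have h : StepsTo 1 ⟨some .clean, (q, x, y), tapes [] (c :: a) [] o⟩
        ⟨some .clean, (q, x, some c), tapes [] a [] o⟩ :=
      .single (congrArg (Turing.TM2.Cfg.mk _ _) (funext fun k => by cases k <;> rfl))
    exact h.trans (ih (some c))

@[simp] lemma length_sweepMap {Q A B : Type} (f : Q → A → Q) (g : Q → A → B) (q : Q) (l : List A) :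
    (sweepMap f g q l).length = l.length := by
  induction l generalizing q with
  | nil => rfl
  | cons x l ih => simp [sweepMap, ih]

/-- The machine prints the output of the last sweep. -/
lemma stepsTo_halt (k : ℕ) (x : S.Conf) (y : Option (Option Bool)) (z : Option S.Cell)
    (halive : ∀ i < k, S.alive (S.sweep^[i] x).1 = true)
    (hdead : S.alive (S.sweep^[k] x).1 = false) :
    -- Each sweep goes back and forth once; the final `2` accounts for the last rewinding and the
    -- cleaning.
    StepsTo ((2 * k + 2) * (x.2.1.length + 1))
      ⟨some .back, (x.1, y, z), tapes [] [] x.2.1.reverse x.2.2⟩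
      ⟨none, (S.init, none, none), tapes [] [] [] (S.sweep^[k] x).2.2⟩ := by
  induction k generalizing x z with
  | zero =>
    have h := stepsTo_back x.1 y z [] x.2.1.reverse x.2.2
    rw [if_neg (by simpa using hdead), List.reverse_reverse, List.length_reverse,
      List.append_nil] at h
    have := h.trans (stepsTo_clean _ _ _ _ _)
    rwa [← two_mul] at this
  | succ k ih =>
    have h := stepsTo_back x.1 y z [] x.2.1.reverse x.2.2
    rw [if_pos (show S.alive x.1 = true from halive 0 (Nat.succ_pos _)), List.reverse_reverse, List.length_reverse,
      List.append_nil] at h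
    have h' := h.trans (stepsTo_forth x.1 y none x.2.1 [] (none :: x.2.2))
    rw [List.append_nil] at h'
    have h'' := ih (S.sweep x) none (fun i hi => halive (i + 1) (by omega)) hdead
    rw [show (S.sweep x).2.1.length = x.2.1.length from length_sweepMap _ _ _ _] at h''
    have := h'.trans h''
    rw [Function.iterate_succ_apply]
    convert this using 1
    ring

/-- A function computed by polynomially many sweeps is computable in polynomial time. -/
theorem computableInPolyTime {α β : Type} {ea : α → List (Option Bool)}
    {eb : β → List (Option Bool)} {f : α → β} (S : SweepMachine) (k : α → ℕ) (C : ℕ)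
    (hk : ∀ a, k a ≤ C * (ea a).length)
    (halive : ∀ a, ∀ i < k a, S.alive (S.sweep^[i] (S.start (ea a))).1 = true)
    (hdead : ∀ a, S.alive (S.sweep^[k a] (S.start (ea a))).1 = false)
    (hout : ∀ a, (S.sweep^[k a] (S.start (ea a))).2.2 = eb (f a)) :
    Nonempty (Turing.TM2ComputableInPolyTime ea eb f) := by
  refine ⟨{
    tm := S.machine
    inputAlphabet := Equiv.refl _
    outputAlphabet := Equiv.refl _
    -- Reading costs `X + 1` and the rest `(2 * k + 2) * (X + 1)` with `k` at most `C * X`.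
    time := (2 * Polynomial.C C * Polynomial.X + 3) * (Polynomial.X + 1)
    outputsFun := fun a => {
      steps := ((ea a).length + 1) + (2 * k a + 2) * ((ea a).length + 1)
      evals_in_steps := ?_
      steps_le_m := ?_ } }⟩
  · have h1 := stepsTo_read (S := S) (ea a) S.init none none []
    rw [List.append_nil] at h1
    have h2 := h1.trans (stepsTo_halt (k a) (S.start (ea a)) none none (halive a) (hdead a))
    rw [hout, show (S.start (ea a)).2.1.length = (ea a).length from length_sweepMap _ _ _ _] at h2
    have e1 : Turing.initList S.machine (List.map (Equiv.refl (Option Bool)).invFun (ea a)) =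
        ⟨some .read, (S.init, none, none), tapes (ea a) [] [] []⟩ := by
      refine congrArg (Turing.TM2.Cfg.mk _ _) (funext fun k => ?_)
      cases k
      · exact List.map_id _
      all_goals rfl
    have e2 : Turing.haltList S.machine (List.map (Equiv.refl (Option Bool)).invFun (eb (f a))) =
        ⟨none, (S.init, none, none), tapes [] [] [] (eb (f a))⟩ := by
      refine congrArg (Turing.TM2.Cfg.mk _ _) (funext fun k => ?_)
      cases k
      case out => exact List.map_id _
      all_goals rfl
    exact (congrArg (fun c => (flip bind S.machine.step)^[_] (some c)) e1).trans
      (Eq.trans h2 (congrArg some e2).symm)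
  · have := hk a
    simp only [Polynomial.eval_mul, Polynomial.eval_add, Polynomial.eval_X, Polynomial.eval_one,
      Polynomial.eval_C, Polynomial.eval_ofNat]
    nlinarith [this, Nat.zero_le (ea a).length]

end SweepMachine

end Sweep

/-! ### Printing the adjacency matrix of a gadget graph -/

section Marks

/-- An input symbol with marks for its position `(i', j')` relative to the current position
`(i, j)`: whether `i' = i`, `j' = j`, `i' = j`, and `j' = i`. -/
structure MarkCell : Type where
  sym : Option Bool
  row : Bool
  col : Bool
  tr : Bool
  dcol : Bool
  deriving Inhabited

/-- The state of the machine that prints adjacency matrices of gadget graphs: the kind that is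
printed, the current and the next symbol, and marks of the previous cell and the previous row. -/
structure MarkState (m : ℕ) : Type where
  kind : Fin (m + 1)
  cur : Option (Option Bool)
  nxt : Option (Option Bool)
  pcol : Bool
  pdcol : Bool
  prow : Bool
  ptr : Bool

instance : Finite MarkCell :=
  Finite.of_injective (fun c : MarkCell => (c.sym, c.row, c.col, c.tr, c.dcol)) (by
    rintro ⟨⟩ ⟨⟩ h
    simpa using h)

instance (m : ℕ) : Finite (MarkState m) :=
  Finite.of_injective
    (fun q : MarkState m => (q.kind, q.cur, q.nxt, q.pcol, q.pdcol, q.prow, q.ptr)) (by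
    rintro ⟨⟩ ⟨⟩ h
    simpa using h)

variable {m : ℕ}

/-- The state at the beginning of a sweep. -/
def MarkState.initial (k : Fin (m + 1)) (c : Option (Option Bool)) : MarkState m :=
  -- Column marks wrap around: after an end-of-row position, which is recognised by its symbol, the
  -- next column is 0.
  ⟨k, c, none, decide (c = some none), false, false, decide (c = some none)⟩

/-- The marks of a cell relative to the position after the current one. -/
def MarkState.shift (q : MarkState m) (c : MarkCell) : MarkCell :=
  -- `row` and `dcol` compare with the current row, which changes only at the end of a row. `col`
  -- and `tr` compare with the current column and always move on, inherited from the previous cell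
  -- and the previous row.
  ⟨c.sym, if q.cur = some none then q.prow else c.row, q.pcol, q.ptr,
    if q.cur = some none then q.pdcol else c.dcol⟩

/-- The machine that prints adjacency matrices of gadget graphs. -/
def markMachine (F : Fin (m + 1) → Fin (m + 1) → CellFlags → Bool) : SweepMachine where
  Q := MarkState m
  Cell := MarkCell
  m := m
  init := ⟨0, none, none, true, false, true, false⟩
  readState q s := { q with
    pcol := decide (s = none)
    prow := q.prow && decide (s ≠ none)
    nxt := if q.prow && q.pcol then some s else q.nxt }
  -- At position (0, 0) the marks `tr` and `dcol` coincide with `row` and `col`.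
  readCell q s := ⟨s, q.prow, q.pcol, q.prow, q.pcol⟩
  alive q := q.cur.isSome
  next q c := { q with
    -- The symbol at the next position is picked up in passing. After the last position none is
    -- found, which stops the machine.
    nxt := if (q.shift c).row && (q.shift c).col then some c.sym else q.nxt
    pcol := c.col
    pdcol := c.dcol
    prow := if c.sym = none then c.row else q.prow
    ptr := if c.sym = none then c.tr else q.ptr }
  -- Kinds count down, so kind 0 is the last sweep for a position and the only one that moves the
  -- marks.
  write q c := if q.kind = 0 then q.shift c else c
  bits q c k := F q.kind k ⟨q.cur.getD none, c.sym, c.row, c.col, c.tr, c.dcol⟩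
  turn q := if q.kind = 0 then .initial (Fin.last m) q.nxt else .initial (q.kind - 1) q.cur

/-- The table of a function, in the order of the encoding of graphs. -/
def gridList {A : Type} (n : ℕ) (g : ℕ → ℕ → A) : List A :=
  (List.range n).flatMap fun i => (List.range (n + 1)).map (g i)

lemma sweepState_append {Q A : Type} (f : Q → A → Q) (q : Q) (l l' : List A) :
    sweepState f q (l ++ l') = sweepState f (sweepState f q l) l' := List.foldl_append

lemma sweepMap_append {Q A B : Type} (f : Q → A → Q) (g : Q → A → B) (q : Q) (l l' : List A) :
    sweepMap f g q (l ++ l') = sweepMap f g q l ++ sweepMap f g (sweepState f q l) l' := by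
  induction l generalizing q with
  | nil => rfl
  | cons x l ih => simp [sweepMap, sweepState, ih]

/-- Processing a table whose intermediate states are known. -/
lemma sweep_gridList {Q A B : Type} {f : Q → A → Q} {g : Q → A → B} {n : ℕ} (st : ℕ → ℕ → Q)
    {c : ℕ → ℕ → A} {d : ℕ → ℕ → B}
    (h : ∀ i < n, ∀ j < n, f (st i j) (c i j) = st i (j + 1))
    (h' : ∀ i < n, f (st i n) (c i n) = st (i + 1) 0)
    (hd : ∀ i < n, ∀ j ≤ n, g (st i j) (c i j) = d i j) :
    sweepState f (st 0 0) (gridList n c) = st n 0 ∧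
      sweepMap f g (st 0 0) (gridList n c) = gridList n d := by
  have row : ∀ i < n, ∀ k ≤ n, sweepState f (st i 0) ((List.range k).map (c i)) = st i k ∧
      sweepMap f g (st i 0) ((List.range k).map (c i)) = (List.range k).map (d i) := by
    intro i hi k
    induction k with
    | zero => exact fun _ => ⟨rfl, rfl⟩
    | succ k ih =>
      intro hk
      obtain ⟨h1, h2⟩ := ih (by omega)
      rw [List.range_succ, List.map_append, List.map_append, sweepState_append, sweepMap_append,
        h1, h2]
      exact ⟨h i hi k (by omega), by simp [sweepMap, hd i hi k (by omega)]⟩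
  have row' : ∀ i < n, sweepState f (st i 0) ((List.range (n + 1)).map (c i)) = st (i + 1) 0 ∧
      sweepMap f g (st i 0) ((List.range (n + 1)).map (c i)) = (List.range (n + 1)).map (d i) := by
    intro i hi
    obtain ⟨h1, h2⟩ := row i hi n le_rfl
    rw [List.range_succ, List.map_append, List.map_append, sweepState_append, sweepMap_append,
      h1, h2]
    exact ⟨h' i hi, by simp [sweepMap, hd i hi n le_rfl]⟩
  have all : ∀ k ≤ n, sweepState f (st 0 0)
        ((List.range k).flatMap fun i => (List.range (n + 1)).map (c i)) = st k 0 ∧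
      sweepMap f g (st 0 0) ((List.range k).flatMap fun i => (List.range (n + 1)).map (c i)) =
        (List.range k).flatMap fun i => (List.range (n + 1)).map (d i) := by
    intro k
    induction k with
    | zero => exact fun _ => ⟨rfl, rfl⟩
    | succ k ih =>
      intro hk
      obtain ⟨h1, h2⟩ := ih (by omega)
      obtain ⟨h3, h4⟩ := row' k (by omega)
      rw [List.range_succ (n := k), List.flatMap_append, List.flatMap_append, sweepState_append,
        sweepMap_append, h1, h2]
      simp only [List.flatMap_cons, List.flatMap_nil, List.append_nil]
      exact ⟨h3, by rw [h4]⟩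
  exact all n le_rfl

/-! ### Correctness of the marking machine -/

variable {n : ℕ} (s : ℕ → ℕ → Option Bool)

/-- The marks relative to position `(i, j)`. -/
def markCell (i j i' j' : ℕ) : MarkCell :=
  ⟨s i' j', decide (i' = i), decide (j' = j), decide (i' = j), decide (j' = i)⟩

/-- The state at position `(i', j')` in a sweep for the current position `(i, j)` and the next
position `(a, b)`. -/
def markState (n : ℕ) (k : Fin (m + 1)) (i j a b i' j' : ℕ) : MarkState m where
  kind := k
  cur := some (s i j)
  nxt := if a < i' ∨ a = i' ∧ b < j' then some (s a b) else none
  pcol := if j' = 0 then decide (j = n) else decide (j' - 1 = j)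
  pdcol := if j' = 0 then false else decide (j' - 1 = i)
  prow := decide (i' = i + 1)
  ptr := if i' = 0 then decide (j = n) else decide (i' - 1 = j)

variable {s}

/-- The configuration at the beginning of the sweeps for position `(i, j)`. -/
def markConf (F : Fin (m + 1) → Fin (m + 1) → CellFlags → Bool) (n : ℕ)
    (s : ℕ → ℕ → Option Bool) (k : Fin (m + 1)) (i j : ℕ) (o : List (Option Bool)) :
    (markMachine F).Conf :=
  (.initial k (if i < n then some (s i j) else none), gridList n (markCell s i j), o)

lemma start_markMachine (F : Fin (m + 1) → Fin (m + 1) → CellFlags → Bool)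
    (hs : ∀ i < n, ∀ j ≤ n, s i j = none ↔ j = n) :
    (markMachine F).start (gridList n s) = markConf F n s (Fin.last m) 0 0 [] := by
  let st : ℕ → ℕ → MarkState m := fun i j =>
    ⟨0, none, if 0 < i ∨ 0 < j then some (s 0 0) else none, decide (j = 0), false,
      decide (i = 0), false⟩
  have key := sweep_gridList (n := n) (f := (markMachine F).readState)
    (g := (markMachine F).readCell) st (c := s) (d := markCell s 0 0) (fun i hi j hj => by
      have := (hs i hi j hj.le).not.2 hj.ne
      by_cases hi0 : i = 0 <;> by_cases hj0 : j = 0 <;>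
        simp [st, markMachine, this, hi0, hj0, Nat.pos_of_ne_zero]
      all_goals first | omega | simp_all) (fun i hi => by
      have := (hs i hi n le_rfl).2 rfl
      by_cases hi0 : i = 0 <;> simp [st, markMachine, this, hi0, Nat.pos_of_ne_zero]
      all_goals first | omega | simp_all) (fun i hi j hj => by
      simp [st, markMachine, markCell])
  have h0 : (markMachine F).init = st 0 0 := rfl
  unfold SweepMachine.start markConf
  rw [h0, key.1, key.2]
  simp [markMachine, st]

lemma shift_markState (hs : ∀ i < n, ∀ j ≤ n, s i j = none ↔ j = n) (k : Fin (m + 1))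
    {i j a b : ℕ} (hi : i < n) (hj : j ≤ n) (hab : a = if j = n then i + 1 else i)
    (hb : b = if j = n then 0 else j + 1) {i' j' : ℕ} (hi' : i' < n) (hj' : j' ≤ n) :
    (markState s n k i j a b i' j').shift (markCell s i j i' j') = markCell s a b i' j' := by
  simp only [MarkState.shift, markState, markCell, Option.some.injEq, hs i hi j hj,
    MarkCell.mk.injEq, true_and]
  subst hab hb
  by_cases hjn : j = n
  · simp only [hjn, if_true]
    refine ⟨trivial, ?_, ?_, ?_⟩ <;> split_ifs <;> simp <;> omega
  · simp only [hjn, if_false]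
    refine ⟨trivial, ?_, ?_, trivial⟩ <;> split_ifs <;> simp <;> omega

lemma sweep_markMachine (F : Fin (m + 1) → Fin (m + 1) → CellFlags → Bool)
    (hs : ∀ i < n, ∀ j ≤ n, s i j = none ↔ j = n) (k : Fin (m + 1)) {i j a b : ℕ} (hi : i < n)
    (hj : j ≤ n) (hab : a = if j = n then i + 1 else i) (hb : b = if j = n then 0 else j + 1)
    (o : List (Option Bool)) :
    (markMachine F).sweep (markConf F n s k i j o) =
      (if k = 0 then markConf F n s (Fin.last m) a b else markConf F n s (k - 1) i j)
        ((gridList n fun i' j' => (List.finRange (m + 1)).map fun k' => some (F k k'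
          ⟨s i j, s i' j', decide (i' = i), decide (j' = j), decide (i' = j),
            decide (j' = i)⟩)).reverse.flatten ++ none :: o) := by
  have h0 : MarkState.initial k (if i < n then some (s i j) else none) =
      markState s n k i j a b 0 0 := by
    simp [MarkState.initial, markState, hi, hs i hi j hj]
  have hbn : b ≤ n := by split_ifs at hb <;> omega
  have next1 : ∀ i' < n, ∀ j' < n, (markMachine F).next (markState s n k i j a b i' j')
      (markCell s i j i' j') = markState s n k i j a b i' (j' + 1) := by
    intro i' hi' j' hj'
    have h2 := (hs i' hi' j' hj'.le).not.2 hj'.ne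
    simp only [markMachine, shift_markState hs k hi hj hab hb hi' hj'.le]
    simp only [markState, markCell, h2, if_false, MarkState.mk.injEq, true_and, and_true]
    refine ⟨?_, ?_, ?_⟩
    · by_cases h : i' = a ∧ j' = b
      · simp [h]
      · have h' : ¬ ((decide (i' = a) && decide (j' = b)) = true) := by
          simpa only [Bool.and_eq_true, decide_eq_true_eq] using h
        refine (if_neg h').trans (if_congr ?_ rfl rfl)
        omega
    · simp
    · simp
  have next2 : ∀ i' < n, (markMachine F).next (markState s n k i j a b i' n)
      (markCell s i j i' n) = markState s n k i j a b (i' + 1) 0 := by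
    intro i' hi'
    have h2 := (hs i' hi' n le_rfl).2 rfl
    simp only [markMachine, shift_markState hs k hi hj hab hb hi' le_rfl]
    simp only [markState, markCell, h2, if_true, MarkState.mk.injEq, true_and]
    refine ⟨?_, ?_, ?_, ?_, ?_⟩
    · by_cases h : i' = a ∧ n = b
      · obtain ⟨rfl, rfl⟩ := h
        simp [h2]
      · rw [if_neg (by simpa only [Bool.and_eq_true, decide_eq_true_eq] using h)]
        refine if_congr ?_ rfl rfl
        omega
    · simp [eq_comm]
    · simp; omega
    · simp [eq_comm]
    · simp
  have hblock := sweep_gridList (n := n) (f := (markMachine F).next)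
    (g := (markMachine F).block) _ next1 next2 fun i' hi' j' hj' => rfl
  have hwrite (d : ℕ → ℕ → MarkCell) (hd : ∀ i' j',
      (if k = 0 then markCell s a b i' j' else markCell s i j i' j') = d i' j') :=
    (sweep_gridList (n := n) (f := (markMachine F).next) (g := (markMachine F).write) (d := d)
      _ next1 next2 fun i' hi' j' hj' => by
      simp only [markMachine, shift_markState hs k hi hj hab hb hi' hj']
      exact hd i' j').2
  have hturn : (markMachine F).turn (markState s n k i j a b n 0) =
      if k = 0 then .initial (Fin.last m) (if a < n then some (s a b) else none)
      else .initial (k - 1) (some (s i j)) := by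
    simp [markMachine, markState]
  by_cases hk : k = 0
  · rw [if_pos hk]
    unfold SweepMachine.sweep markConf
    simp only
    rw [h0, hblock.1, hwrite _ fun i' j' => if_pos hk, hblock.2, hturn.trans (if_pos hk)]
    rfl
  · rw [if_neg hk]
    unfold SweepMachine.sweep markConf
    simp only
    rw [h0, hblock.1, hwrite _ fun i' j' => if_neg hk, hblock.2, hturn.trans (if_neg hk), if_pos hi]
    rfl

/-- Whether `k` sweeps lead from `x` to `y`. -/
def SweepMachine.SweepsTo (S : SweepMachine) (k : ℕ) (x y : S.Conf) : Prop :=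
  S.sweep^[k] x = y ∧ ∀ l < k, S.alive (S.sweep^[l] x).1 = true

lemma SweepMachine.SweepsTo.trans {S : SweepMachine} {k l : ℕ} {x y z : S.Conf}
    (h : S.SweepsTo k x y) (h' : S.SweepsTo l y z) : S.SweepsTo (k + l) x z := by
  refine ⟨by rw [Nat.add_comm, Function.iterate_add_apply, h.1, h'.1], fun i hi => ?_⟩
  by_cases hik : i < k
  · exact h.2 i hik
  · obtain ⟨d, rfl⟩ := Nat.exists_eq_add_of_le (not_lt.1 hik)
    rw [Nat.add_comm, Function.iterate_add_apply, h.1]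
    exact h'.2 d (by omega)

lemma SweepMachine.SweepsTo.single {S : SweepMachine} {x y : S.Conf} (hx : S.alive x.1 = true)
    (h : S.sweep x = y) : S.SweepsTo 1 x y :=
  ⟨h, fun i hi => by obtain rfl : i = 0 := by omega
                     exact hx⟩

/-- The row of a vertex of kind `k` at position `(i, j)`. -/
def markRow (F : Fin (m + 1) → Fin (m + 1) → CellFlags → Bool) (n : ℕ) (s : ℕ → ℕ → Option Bool)
    (i j : ℕ) (k : Fin (m + 1)) : List (Option Bool) :=
  (gridList n fun i' j' => (List.finRange (m + 1)).map fun k' => some (F k k'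
    ⟨s i j, s i' j', decide (i' = i), decide (j' = j), decide (i' = j),
      decide (j' = i)⟩)).reverse.flatten ++ [none]

/-- The rows of all the vertices at position `(i, j)`. -/
def markRows (F : Fin (m + 1) → Fin (m + 1) → CellFlags → Bool) (n : ℕ) (s : ℕ → ℕ → Option Bool)
    (i j : ℕ) : List (Option Bool) :=
  (List.finRange (m + 1)).flatMap (markRow F n s i j)

/-- Kinds are swept in decreasing order, so on the output stack their rows appear in increasing
order. -/
lemma sweepsTo_position (F : Fin (m + 1) → Fin (m + 1) → CellFlags → Bool)
    (hs : ∀ i < n, ∀ j ≤ n, s i j = none ↔ j = n) {i j a b : ℕ} (hi : i < n)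
    (hj : j ≤ n) (hab : a = if j = n then i + 1 else i) (hb : b = if j = n then 0 else j + 1)
    (o : List (Option Bool)) :
    (markMachine F).SweepsTo (m + 1) (markConf F n s (Fin.last m) i j o)
      (markConf F n s (Fin.last m) a b (markRows F n s i j ++ o)) := by
  have halive : ∀ k o, (markMachine F).alive (markConf F n s k i j o).1 = true := by
    intro k o
    simp [markMachine, markConf, hi, MarkState.initial]
  have key : ∀ (k : ℕ) (hk : k < m + 1) (o : List (Option Bool)),
      (markMachine F).SweepsTo (k + 1) (markConf F n s ⟨k, hk⟩ i j o)
        (markConf F n s (Fin.last m) a b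
          (((List.finRange (m + 1)).take (k + 1)).flatMap (markRow F n s i j) ++ o)) := by
    intro k
    induction k with
    | zero =>
      intro hk o
      refine .single (halive _ _) ?_
      rw [sweep_markMachine F hs _ hi hj hab hb, if_pos (by rfl)]
      simp [markRow, List.take_succ_eq_append_getElem]
    | succ k ih =>
      intro hk o
      have h1 : (markMachine F).sweep (markConf F n s ⟨k + 1, hk⟩ i j o) =
          markConf F n s ⟨k, by omega⟩ i j (markRow F n s i j ⟨k + 1, hk⟩ ++ o) := by
        rw [sweep_markMachine F hs _ hi hj hab hb, if_neg (by simp [Fin.ext_iff]),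
          show (⟨k + 1, hk⟩ : Fin (m + 1)) - 1 = ⟨k, by omega⟩ from ?_]
        · simp [markRow]
        · rw [sub_eq_iff_eq_add]
          ext
          rw [Fin.val_add_one_of_lt (by simpa [Fin.lt_def] using hk)]
      have h2 := (SweepMachine.SweepsTo.single (halive _ _) h1).trans (ih (by omega) _)
      rw [Nat.add_comm] at h2
      rw [List.take_succ_eq_append_getElem (i := k + 1) (by simpa using hk)]
      simpa using h2
  have h := key m (Nat.lt_succ_self m) o
  rwa [List.take_of_length_le (by simp)] at h

/-- The sweeps for all the positions. -/
lemma sweepsTo_all (F : Fin (m + 1) → Fin (m + 1) → CellFlags → Bool)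
    (hs : ∀ i < n, ∀ j ≤ n, s i j = none ↔ j = n) :
    (markMachine F).SweepsTo ((m + 1) * (n * (n + 1))) (markConf F n s (Fin.last m) 0 0 [])
      (markConf F n s (Fin.last m) n 0 (gridList n (markRows F n s)).reverse.flatten) := by
  have row : ∀ i < n, ∀ k ≤ n, ∀ o, (markMachine F).SweepsTo ((m + 1) * k)
      (markConf F n s (Fin.last m) i 0 o) (markConf F n s (Fin.last m) i k
        (((List.range k).map (markRows F n s i)).reverse.flatten ++ o)) := by
    intro i hi k
    induction k with
    | zero => exact fun _ o => ⟨rfl, fun l hl => absurd hl (by simp)⟩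
    | succ k ih =>
      intro hk o
      have h := (ih (by omega) o).trans (sweepsTo_position F hs hi (by omega : k ≤ n)
        (if_neg (by omega)).symm (if_neg (by omega)).symm _)
      rw [List.range_succ]
      simpa [mul_add] using h
  have row' : ∀ i < n, ∀ o, (markMachine F).SweepsTo ((m + 1) * (n + 1))
      (markConf F n s (Fin.last m) i 0 o) (markConf F n s (Fin.last m) (i + 1) 0
        (((List.range (n + 1)).map (markRows F n s i)).reverse.flatten ++ o)) := by
    intro i hi o
    have h := (row i hi n le_rfl o).trans (sweepsTo_position F hs hi le_rfl
      (if_pos rfl).symm (if_pos rfl).symm _)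
    rw [List.range_succ]
    simpa [mul_add] using h
  have all : ∀ k ≤ n, (markMachine F).SweepsTo ((m + 1) * (k * (n + 1)))
      (markConf F n s (Fin.last m) 0 0 []) (markConf F n s (Fin.last m) k 0
        ((List.range k).flatMap fun i =>
          (List.range (n + 1)).map (markRows F n s i)).reverse.flatten) := by
    intro k
    induction k with
    | zero => exact fun _ => ⟨by simp, fun l hl => absurd hl (by simp)⟩
    | succ k ih =>
      intro hk
      have h := (ih (by omega)).trans (row' k (by omega) _)
      rw [List.range_succ (n := k), List.flatMap_append,
        show (m + 1) * ((k + 1) * (n + 1)) = (m + 1) * (k * (n + 1)) + (m + 1) * (n + 1) by ring]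
      simpa using h
  exact all n le_rfl

end Marks

/-! ### The encoding as a finite graph and its computation -/

section Encoding

variable {n r m : ℕ}

/-- The cells of the table of a graph, in the order of its encoding. -/
def gridCells (n : ℕ) : List (GridCell n) :=
  (List.finRange n).flatMap fun i => (List.finRange n).map (fun j => (i, some j)) ++ [(i, none)]

/-- The column of a cell. -/
def cellColumn (c : GridCell n) : ℕ := c.2.elim n Fin.val

lemma mem_gridCells (c : GridCell n) : c ∈ gridCells n := by
  rcases c with ⟨i, _ | j⟩ <;> simp [gridCells]

lemma nodup_gridCells (n : ℕ) : (gridCells n).Nodup := by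
  rw [gridCells, List.nodup_flatMap]
  refine ⟨fun i _ => ?_, ?_⟩
  · rw [List.nodup_append]
    refine ⟨(List.nodup_finRange n).map fun a b h => by simpa using h, by simp, ?_⟩
    simp
  · refine (List.nodup_finRange n).imp ?_
    intro i j hij
    simp only [Function.onFun]
    intro x hx hy
    simp only [List.mem_append, List.mem_map, List.mem_finRange, true_and, List.mem_singleton]
      at hx hy
    refine hij ?_
    have h1 : x.1 = i := by rcases hx with ⟨_, rfl⟩ | rfl <;> rfl
    have h2 : x.1 = j := by rcases hy with ⟨_, rfl⟩ | rfl <;> rfl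
    exact h1.symm.trans h2

lemma gridList_eq_map {A : Type} (g : ℕ → ℕ → A) :
    gridList n g = (gridCells n).map fun c => g c.1 (cellColumn c) := by
  unfold gridList gridCells
  rw [← List.map_coe_finRange_eq_range (n := n), List.flatMap_map, List.map_flatMap]
  refine congrArg (fun f => List.flatMap f _) (funext fun i => ?_)
  simp only [List.range_succ, List.map_append, List.map_map, List.map_cons, List.map_nil,
    Function.comp_def, cellColumn, Option.elim_some, Option.elim_none]
  rw [← List.map_coe_finRange_eq_range, List.map_map]
  rfl

open Classical in
/-- The symbols of the encoding of a graph. -/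
noncomputable def graphSymbol (H : SimpleGraph (Fin n)) (i j : ℕ) : Option Bool :=
  if h : i < n ∧ j < n then some (decide (H.Adj ⟨i, h.1⟩ ⟨j, h.2⟩)) else none

lemma graphSymbol_cell (H : SimpleGraph (Fin n)) (c : GridCell n) :
    graphSymbol H c.1 (cellColumn c) = cellSymbol H c := by
  rcases c with ⟨i, _ | j⟩
  · simp [graphSymbol, cellColumn, cellSymbol]
  · exact dif_pos ⟨i.2, j.2⟩

lemma graphSymbol_eq_none (H : SimpleGraph (Fin n)) (i : ℕ) (hi : i < n) (j : ℕ) (hj : j ≤ n) :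
    graphSymbol H i j = none ↔ j = n := by
  unfold graphSymbol
  split_ifs with h <;> simp <;> omega

lemma encodeGraph_eq_gridList (H : FinGraph) :
    encodeGraph H = gridList H.1 (graphSymbol H.2) := by
  rw [gridList_eq_map]
  simp only [graphSymbol_cell]
  simp [encodeGraph, gridCells, List.map_flatMap, cellSymbol, Function.comp_def]

lemma cellFlags_eq (H : SimpleGraph (Fin n)) (c d : GridCell n) :
    (⟨graphSymbol H c.1 (cellColumn c), graphSymbol H d.1 (cellColumn d),
      decide ((d.1 : ℕ) = c.1), decide (cellColumn d = cellColumn c),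
      decide ((d.1 : ℕ) = cellColumn c), decide (cellColumn d = c.1)⟩ : CellFlags) =
      cellFlags H c d := by
  rw [graphSymbol_cell, graphSymbol_cell]
  obtain ⟨i, o⟩ := c
  obtain ⟨i', o'⟩ := d
  simp only [cellFlags, CellFlags.mk.injEq, true_and, decide_eq_decide]
  refine ⟨by rw [eq_comm, Fin.ext_iff], ?_, ?_, ?_⟩
  · rcases o with _ | j <;> rcases o' with _ | j'
    · simp [cellColumn]
    · simp [cellColumn, j'.2.ne]
    · simp [cellColumn, j.2.ne']
    · simp [cellColumn, Fin.ext_iff, eq_comm]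
  · rcases o with _ | j
    · simp [cellColumn, i'.2.ne]
    · simp [cellColumn, Fin.ext_iff, eq_comm]
  · rcases o' with _ | j <;> simp [cellColumn, Fin.ext_iff, i.2.ne']

/-- A list of the vertices of the gadget graph. -/
def gadgetVertices (κ : GadgetKind r ≃ Fin (m + 1)) (n : ℕ) : List (GridCell n × GadgetKind r) :=
  -- Cells are reversed but kinds are not: this is the order in which the machine's output stack
  -- lists rows and entries.
  (gridCells n).reverse.flatMap fun c => (List.finRange (m + 1)).map fun k => (c, κ.symm k)

lemma mem_gadgetVertices (κ : GadgetKind r ≃ Fin (m + 1)) (u : GridCell n × GadgetKind r) :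
    u ∈ gadgetVertices κ n := by
  simp only [gadgetVertices, List.mem_flatMap, List.mem_reverse, List.mem_map]
  exact ⟨u.1, mem_gridCells _, κ u.2, List.mem_finRange _, by simp⟩

lemma nodup_gadgetVertices (κ : GadgetKind r ≃ Fin (m + 1)) (n : ℕ) :
    (gadgetVertices κ n).Nodup := by
  rw [gadgetVertices, List.nodup_flatMap]
  refine ⟨fun c _ => (List.nodup_finRange _).map fun a b h => by simpa using h, ?_⟩
  refine (List.nodup_reverse.2 (nodup_gridCells n)).imp ?_
  intro c d hcd x hx hy
  simp only [List.mem_map, List.mem_finRange, true_and] at hx hy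
  obtain ⟨k, rfl⟩ := hx
  obtain ⟨k', h⟩ := hy
  exact hcd (congrArg Prod.fst h).symm

/-- The gadget graph with vertices numbered by the list of its vertices. -/
noncomputable def gadgetFinGraph (κ : GadgetKind r ≃ Fin (m + 1)) (hr : 0 < r)
    (R : Fin (r + 2) → Fin (r + 2) → Prop) (hR : ∀ a b, R a b → R b a) (H : FinGraph) : FinGraph :=
  ⟨(gadgetVertices κ H.1).length,
    (gadgetGraph hr R hR H.2).comap (gadgetVertices κ H.1).get⟩

variable (κ : GadgetKind r ≃ Fin (m + 1)) (hr : 0 < r)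
    (R : Fin (r + 2) → Fin (r + 2) → Prop) (hR : ∀ a b, R a b → R b a)

/-- The numbering of the vertices of the gadget graph. -/
noncomputable def gadgetIso (H : FinGraph) :
    (gadgetFinGraph κ hr R hR H).2 ≃g gadgetGraph hr R hR H.2 where
  toEquiv := Equiv.ofBijective (gadgetVertices κ H.1).get
    ⟨(nodup_gadgetVertices κ H.1).injective_get, fun u =>
      List.mem_iff_get.1 (mem_gadgetVertices κ u)⟩
  map_rel_iff' := Iff.rfl

lemma card_gadgetFinGraph (H : FinGraph) :
    (gadgetFinGraph κ hr R hR H).1 = H.1 * (H.1 + 1) * (m + 1) := by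
  have h := Nat.card_congr (gadgetIso κ hr R hR H).toEquiv
  rw [Nat.card_prod, Nat.card_congr κ, Nat.card_prod] at h
  simpa using h

open Classical in
lemma encodeGraph_comap_get {V : Type} (l : List V) (G : SimpleGraph V) :
    encodeGraph ⟨l.length, G.comap l.get⟩ =
      l.flatMap fun u => l.map (fun v => some (decide (G.Adj u v))) ++ [none] := by
  conv_rhs => rw [← List.map_get_finRange l]
  rw [List.flatMap_map]
  simp only [List.map_map]
  rfl

open Classical in
/-- Whether gadget vertices with given kinds and flags are adjacent. -/
noncomputable def gadgetBit (x y : Fin (m + 1)) (z : CellFlags) : Bool :=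
  decide ((κ.symm x).Linked hr R (κ.symm y) z)

lemma encodeGraph_gadgetFinGraph (H : FinGraph) :
    encodeGraph (gadgetFinGraph κ hr R hR H) =
      (gridList H.1 (markRows (gadgetBit κ hr R) H.1 (graphSymbol H.2))).reverse.flatten := by
  unfold gadgetFinGraph
  rw [encodeGraph_comap_get, gridList_eq_map, ← List.map_reverse, ← List.flatMap_def]
  conv_lhs => rw [gadgetVertices, List.flatMap_assoc]
  refine congrArg (fun f => List.flatMap f _) (funext fun c => ?_)
  rw [List.flatMap_map, markRows]
  refine congrArg (fun f => List.flatMap f _) (funext fun k => ?_)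
  rw [markRow, gridList_eq_map, ← List.map_reverse, ← List.flatMap_def, List.map_flatMap]
  refine congrArg (fun f => List.flatMap f _ ++ _) (funext fun d => ?_)
  simp only [List.map_map, gadgetBit, Function.comp_def]
  refine List.map_congr_left fun k' _ => congrArg some (decide_eq_decide.2 ?_)
  refine (gadgetGraph_adj hr R hR H.2 _ _).trans ?_
  exact Iff.of_eq (congrArg ((κ.symm k).Linked hr R (κ.symm k')) (cellFlags_eq H.2 c d).symm)

lemma computable_gadgetFinGraph : Nonempty (Turing.TM2ComputableInPolyTime
    (fun H : {H : FinGraph // H ∈ (Set.univ : Set FinGraph)} => encodeGraph H.1) encodeGraph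
    fun H => gadgetFinGraph κ hr R hR H.1) := by
  have hstart := fun H : FinGraph => start_markMachine (gadgetBit κ hr R)
    (graphSymbol_eq_none H.2)
  have hall := fun H : FinGraph => sweepsTo_all (gadgetBit κ hr R) (graphSymbol_eq_none H.2)
  refine SweepMachine.computableInPolyTime (markMachine (gadgetBit κ hr R))
    (fun H => (m + 1) * (H.1.1 * (H.1.1 + 1))) (m + 1) ?_ ?_ ?_ ?_
  · intro H
    refine Nat.mul_le_mul_left _ (le_of_eq ?_)
    simp [encodeGraph]
  · intro H i hi
    simp only [encodeGraph_eq_gridList, hstart]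
    exact (hall H.1).2 i hi
  · intro H
    simp only [encodeGraph_eq_gridList, hstart]
    rw [(hall H.1).1]
    simp [markConf, markMachine, MarkState.initial]
  · intro H
    rw [encodeGraph_gadgetFinGraph]
    simp only [encodeGraph_eq_gridList, hstart]
    rw [(hall H.1).1]
    rfl

end Encoding

/-! ### The interpretation -/

section Interpretation

variable {r m : ℕ} (κ : GadgetKind r ≃ Fin (m + 1)) (hr : 0 < r)
  (R : Fin (r + 2) → Fin (r + 2) → Prop) (hR : ∀ a b, R a b → R b a)

/-- The formula saying that the gadget graph of `K` embeds with the hubs at the free variables. -/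
noncomputable def gadgetFormula (K : FinGraph) : Language.graph.Formula (Fin K.1) :=
  patternFormula (gadgetFinGraph κ hr R hR K).2
    fun i => (gadgetIso κ hr R hR K).symm (gadgetHub i)

lemma graphSat_gadgetFormula (K : FinGraph) {V : Type} (G : SimpleGraph V) (x : Fin K.1 → V) :
    GraphSat G (gadgetFormula κ hr R hR K) x ↔
      ∃ e : gadgetGraph hr R hR K.2 ↪g G, ∀ i, e (gadgetHub i) = x i := by
  rw [gadgetFormula, graphSat_patternFormula]
  constructor
  · rintro ⟨e, he⟩
    exact ⟨(gadgetIso κ hr R hR K).symm.toRelEmbedding.trans e, he⟩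
  · rintro ⟨e, he⟩
    exact ⟨(gadgetIso κ hr R hR K).toRelEmbedding.trans e, fun i => by simp [← he]⟩

lemma gadgetHub_injective {n : ℕ} : Function.Injective (gadgetHub (r := r) (n := n)) := by
  intro i j h
  simpa [gadgetHub] using h

/-- The interpretation of all graphs in their gadget graphs. -/
noncomputable def gadgetInterpretation : Interpretation where
  δ := gadgetFormula κ hr R hR ⟨1, ⊥⟩
  φ := gadgetFormula κ hr R hR ⟨2, ⊤⟩
  irrefl G u h := by
    obtain ⟨e, he⟩ := (graphSat_gadgetFormula κ hr R hR ⟨2, ⊤⟩ G _).1 h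
    have h := gadgetHub_injective (e.injective ((he (0 : Fin 2)).trans (he (1 : Fin 2)).symm))
    exact absurd h (by decide)
  symm G u v h := by
    obtain ⟨e, he⟩ := (graphSat_gadgetFormula κ hr R hR ⟨2, ⊤⟩ G _).1 h
    -- Exchanging the ends of the edge induces an embedding of its gadget that exchanges the two
    -- hubs.
    let swap : (⊤ : SimpleGraph (Fin 2)) ↪g (⊤ : SimpleGraph (Fin 2)) :=
      (SimpleGraph.Iso.completeGraph (Equiv.swap 0 1)).toEmbedding
    refine (graphSat_gadgetFormula κ hr R hR ⟨2, ⊤⟩ G _).2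
      ⟨(gadgetGraphMap hr R hR swap).trans e, fun i => ?_⟩
    have h : ∀ i : Fin 2, (gadgetGraphMap hr R hR swap).trans e (gadgetHub i) =
        ![u, v] (Equiv.swap 0 1 i) := fun i => he (Equiv.swap 0 1 i)
    refine (h i).trans ?_
    revert i
    exact Fin.forall_fin_two.2 ⟨rfl, rfl⟩

lemma isExistential_gadgetInterpretation : (gadgetInterpretation κ hr R hR).IsExistential :=
  ⟨isExistentialFormula_patternFormula _ _, isExistentialFormula_patternFormula _ _⟩

-- Rigidity (`exists_hub_map`) gives one direction, functoriality of gadgets the other; the edge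
-- version combines `adj_of_hub_map` with functoriality.
variable {hr R hR} in
lemma exists_embedding_hub_iff {n : ℕ} {H : SimpleGraph (Fin n)}
    (v : GridCell n × GadgetKind r) :
    (∃ e : gadgetGraph hr R hR (⊥ : SimpleGraph (Fin 1)) ↪g gadgetGraph hr R hR H,
      e (gadgetHub 0) = v) ↔ ∃ i, v = gadgetHub i := by
  constructor
  · rintro ⟨e, rfl⟩
    exact exists_hub_map e 0
  · rintro ⟨i, rfl⟩
    let c : (⊥ : SimpleGraph (Fin 1)) ↪g H :=
      ⟨⟨fun _ => i, fun a b _ => Subsingleton.elim a b⟩, by simp⟩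
    exact ⟨gadgetGraphMap hr R hR c, rfl⟩

variable {hr R hR} in
lemma exists_embedding_hub_hub_iff {n : ℕ} {H : SimpleGraph (Fin n)} (i j : Fin n) :
    (∃ e : gadgetGraph hr R hR (⊤ : SimpleGraph (Fin 2)) ↪g gadgetGraph hr R hR H,
      e (gadgetHub 0) = gadgetHub i ∧ e (gadgetHub 1) = gadgetHub j) ↔ H.Adj i j := by
  constructor
  · rintro ⟨e, hi, hj⟩
    exact adj_of_hub_map e (by simp) hi hj
  · intro hij
    let c : (⊤ : SimpleGraph (Fin 2)) ↪g H :=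
      ⟨⟨![i, j], by
        intro a b
        fin_cases a <;> fin_cases b <;> simp [hij.ne, hij.ne']⟩, by
        intro a b
        change H.Adj (![i, j] a) (![i, j] b) ↔ a ≠ b
        fin_cases a <;> fin_cases b <;> simp [hij, hij.symm]⟩
    exact ⟨gadgetGraphMap hr R hR c, rfl, rfl⟩

lemma graphSat_domain_iff (H : FinGraph) (v : Fin (gadgetFinGraph κ hr R hR H).1) :
    GraphSat (gadgetFinGraph κ hr R hR H).2 (gadgetInterpretation κ hr R hR).δ ![v] ↔
      ∃ i, v = (gadgetIso κ hr R hR H).symm (gadgetHub i) := by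
  let ι := gadgetIso κ hr R hR H
  have h := exists_embedding_hub_iff (hr := hr) (R := R) (hR := hR) (H := H.2) (ι v)
  refine (graphSat_gadgetFormula κ hr R hR ⟨1, ⊥⟩ _ _).trans ?_
  have h2 : (∃ i, ι v = gadgetHub i) ↔ ∃ i, v = ι.symm (gadgetHub i) :=
    exists_congr fun i => ι.toEquiv.eq_symm_apply.symm
  rw [← h2, ← h]
  constructor
  · rintro ⟨e, he⟩
    exact ⟨e.trans ι.toRelEmbedding, congrArg ι (he (0 : Fin 1))⟩
  · rintro ⟨e, he⟩
    refine ⟨e.trans ι.symm.toRelEmbedding, fun i => ?_⟩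
    obtain rfl : i = (0 : Fin 1) := Subsingleton.elim (α := Fin 1) _ _
    exact (congrArg ι.symm he).trans (ι.symm_apply_apply v)

lemma graphSat_edge_iff (H : FinGraph) (i j : Fin H.1) :
    GraphSat (gadgetFinGraph κ hr R hR H).2 (gadgetInterpretation κ hr R hR).φ
      ![(gadgetIso κ hr R hR H).symm (gadgetHub i), (gadgetIso κ hr R hR H).symm (gadgetHub j)] ↔
      H.2.Adj i j := by
  let ι := gadgetIso κ hr R hR H
  rw [← exists_embedding_hub_hub_iff (hr := hr) (R := R) (hR := hR)]
  refine (graphSat_gadgetFormula κ hr R hR ⟨2, ⊤⟩ _ _).trans ?_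
  constructor
  · rintro ⟨e, he⟩
    exact ⟨e.trans ι.toRelEmbedding,
      (congrArg ι (he (0 : Fin 2))).trans (ι.apply_symm_apply _),
      (congrArg ι (he (1 : Fin 2))).trans (ι.apply_symm_apply _)⟩
  · rintro ⟨e, h0, h1⟩
    exact ⟨e.trans ι.symm.toRelEmbedding,
      Fin.forall_fin_two.2 ⟨congrArg ι.symm h0, congrArg ι.symm h1⟩⟩

/-- The interpretation recovers the encoded graph. -/
lemma nonempty_interpretation_iso (H : FinGraph) :
    Nonempty ((gadgetInterpretation κ hr R hR).apply (gadgetFinGraph κ hr R hR H).2 ≃g H.2) := by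
  let ι := gadgetIso κ hr R hR H
  let f : Fin H.1 → {v // GraphSat (gadgetFinGraph κ hr R hR H).2
      (gadgetInterpretation κ hr R hR).δ ![v]} := fun i =>
    ⟨ι.symm (gadgetHub i), (graphSat_domain_iff κ hr R hR H _).2 ⟨i, rfl⟩⟩
  have hf : f.Bijective := by
    constructor
    · intro i j h
      exact gadgetHub_injective (ι.symm.injective (congrArg Subtype.val h))
    · rintro ⟨v, hv⟩
      obtain ⟨i, rfl⟩ := (graphSat_domain_iff κ hr R hR H v).1 hv
      exact ⟨i, rfl⟩
  exact ⟨RelIso.symm ⟨Equiv.ofBijective f hf, fun {i j} => graphSat_edge_iff κ hr R hR H i j⟩⟩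

end Interpretation

/-! ### Assembly of the interpretation and its computation -/

theorem mainTheorem9 (r k : ℕ) (hr : 3 ≤ r) (C : Set FinGraph) (hC : IsHereditary C)
    (hflip : ∀ n : ℕ, ∃ G : SimpleGraph (BicliqueVertex r n),
      IsFlip k (subdividedBiclique r n) G ∧ ClassContains C G) :
    EffectivelyExistentiallyInterprets C Set.univ := by
  obtain ⟨R, hR, hRC⟩ := exists_forall_layerFlip_mem hC hflip
  obtain ⟨m, ⟨κ⟩⟩ : ∃ m, Nonempty (GadgetKind r ≃ Fin (m + 1)) := by
    obtain ⟨n, ⟨h⟩⟩ := Finite.exists_equiv_fin (GadgetKind r)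
    rcases n with _ | m
    · exact (h GadgetKind.hub).elim0
    · exact ⟨m, ⟨h⟩⟩
  have hr : 0 < r := by omega
  refine ⟨gadgetInterpretation κ hr R hR, isExistential_gadgetInterpretation κ hr R hR,
    fun H => gadgetFinGraph κ hr R hR H.1, computable_gadgetFinGraph κ hr R hR,
    ⟨.X * (.X + 1) * .C (m + 1), fun H => ?_⟩, fun H => ⟨hRC (hostSize r H.1.1) _ ⟨?_⟩,
      nonempty_interpretation_iso κ hr R hR H.1⟩⟩
  · simp [card_gadgetFinGraph]
  · exact (gadgetIso κ hr R hR H.1).toRelEmbedding.trans (gadgetGraphEmbedding hr R hR H.1.2)
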